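/- Assume $\mathrm{NP}\nsubseteq\mathrm{P/poly}$. Then there exists a weighted language $\tilde p:\{0,1\}^*\to\mathbb{R}_{\ge 0}$ such that: (i) $\tilde p$ is normalizable, i.e. $Z=\sum_{x}\tilde p(x)$ is finite and strictly positive; (ii) $\tilde p$ is efficiently computable, i.e. its values are rational and a deterministic Turing machine computes $\tilde p(x)$ from $x$ in time polynomial in $|x|$; (iii) for every real $\lambda\ge 1$ there are no deterministic Turing machine $M$ and parameter strings $\theta_n\in\{0,1\}^*$ ($n\in\mathbb{N}$) satisfying all of the following: - the length $|\theta_n|$ is $O(\mathrm{poly}(n))$; - on input $\theta_n$, $M$ runs in time $O(\mathrm{poly}(n))$ and outputs (the description of) a probabilistic Turing machine $q_n$ that maps each input $\hat x x$ with $\hat x\in\{0,1\}^*$, $|\hat x|\le n$ and $x\in\{0,1,\$\}$ to a random number in $\mathbb{Q}\cap[0,1]$; - the worst-case runtime of $q_n$ on these inputs (which have length at most $n+1$) is $O(\mathrm{poly}(n))$; - for all $\hat x\in\{0,1\}^*$ with $|\hat x|\le n$ and all $x\in\{0,1,\$\}$ with $p(x\mid\hat x)>0$, with probability greater than $2/3$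 the output $r=q_n(\hat x x)$ approximates $p(x\mid\hat x)$ to within a factor of $\lambda$, that is, $r/\lambda\le p(x\mid\hat x)\le\lambda r$. Here $Z(\hat x)$ is the sum of $\tilde p(y)$ over all strings $y$ that have $\hat x$ as a prefix, and, whenever $Z(\hat x)>0$, the local conditional probabilities are $p(x\mid\hat x)=Z(\hat x x)/Z(\hat x)$ for $x\in\{0,1\}$ and $p(\$\mid\hat x)=\tilde p(\hat x)/Z(\hat x)$ for the end-of-string symbol $\$$. -/

import Mathlib

open scoped NNReal

namespace LocalNorm

/-! Deterministic Turing machines and the classes NP and P/poly -/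

/-- The deterministic multitape machine `M`, started on the input string `inp`, halts within `t`
steps with the output string `out`. -/
def Computes {A B : Type} (M : Turing.TM2ComputableAux A B) (inp : List A) (out : List B)
    (t : ℕ) : Prop :=
  Nonempty (Turing.TM2OutputsInTime M.tm (inp.map M.inputAlphabet.invFun)
    (some (out.map M.outputAlphabet.invFun)) t)

/-- The string `u#v` over `{0, 1, #}`, with `none` in the role of the separator `#`. -/
def pairEnc (u v : List Bool) : List (Option Bool) :=
  u.map some ++ none :: v.map some

/-- The class NP: there are a polynomial-time verifier `V`, which outputs the verdict `v x w` on
every input `x#w`, and a polynomial `p` such that `x ∈ L` iff some witness of length `p(|x|)` is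
accepted together with `x`. -/
def NP : Set (Language Bool) :=
  {L | ∃ (V : Turing.TM2ComputableAux (Option Bool) Bool) (v : List Bool → List Bool → Bool)
      (p t : Polynomial ℕ),
    (∀ x w, Computes V (pairEnc x w) [v x w] (t.eval (x.length + w.length))) ∧
    ∀ x, x ∈ L ↔ ∃ w : List Bool, w.length = p.eval x.length ∧ v x w = true}

open Classical in
/-- The class P/poly: there are a machine `M` and advice strings `α n` of polynomial length such
that `M`, on input `α(|x|)#x`, decides in time polynomial in `|x|` whether `x ∈ L`. -/
noncomputable def PPoly : Set (Language Bool) :=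
  {L | ∃ (M : Turing.TM2ComputableAux (Option Bool) Bool) (α : ℕ → List Bool)
      (p t : Polynomial ℕ),
    (∀ n, (α n).length ≤ p.eval n) ∧
    ∀ x, Computes M (pairEnc (α x.length) x) [decide (x ∈ L)] (t.eval x.length)}

/-! Weighted languages -/

/-- The natural number with the given binary digits, least significant digit first. -/
def binValue (l : List Bool) : ℕ := Nat.ofDigits 2 (l.map Bool.toNat)

/-- The string `s = u#v` represents the rational number `r = u / v`, with `u` and `v` written in
binary and `v ≠ 0`. -/
def RepresentsRat (s : List (Option Bool)) (r : ℚ) : Prop :=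
  ∃ u v : List Bool, s = pairEnc u v ∧ binValue v ≠ 0 ∧ r = (binValue u : ℚ) / binValue v

/-- A weighted language over the alphabet `{0, 1}`. -/
abbrev WeightedLanguage : Type := List Bool → ℝ≥0

/-- The global normalizing constant `Z` is finite and strictly positive. -/
def Normalizable (p : WeightedLanguage) : Prop :=
  Summable p ∧ 0 < ∑' x, p x

/-- `Z(y)`, the total weight of all strings that have `y` as a prefix. -/
noncomputable def prefixWeight (p : WeightedLanguage) (y : List Bool) : ℝ≥0 :=
  ∑' x : {x : List Bool // y <+: x}, p x

/-- The local conditional probability `p(a | y)` of the next symbol `a`, where `none` is the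
end-of-string symbol `$`: it is `Z(ya) / Z(y)` for `a ∈ {0, 1}`, and the weight of `y` divided by
`Z(y)` for `$`. Only meaningful if `Z(y) > 0`; otherwise the value is `0`. -/
noncomputable def localProb (p : WeightedLanguage) (y : List Bool) : Option Bool → ℝ≥0
  | some a => prefixWeight p (y ++ [a]) / prefixWeight p y
  | none => p y / prefixWeight p y

/-- A deterministic Turing machine maps every `x` to the (rational) weight of `x`, in time
polynomial in `|x|`. -/
def EfficientlyComputable (p : WeightedLanguage) : Prop :=
  ∃ (M : Turing.TM2ComputableAux Bool (Option Bool)) (t : Polynomial ℕ),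
    ∀ x, ∃ (s : List (Option Bool)) (r : ℚ),
      Computes M x s (t.eval x.length) ∧ RepresentsRat s r ∧ (r : ℝ) = p x

/-! Probabilistic Turing machines, as finite objects that another machine can write down -/

/-- What a machine does in one step: enter state `next`, write the symbol `write`, move the head
by one cell. -/
structure Action where
  next : ℕ
  write : ℕ
  dir : Turing.Dir

/-- A rule of a probabilistic machine: in state `state`, with the symbol `read` under the head,
perform `act₀` or `act₁`, according to the outcome of a fair coin. -/
structure Rule where
  state : ℕ
  read : ℕ
  act₀ : Action
  act₁ : Action

/-- A probabilistic single-tape Turing machine, given by the finite table of its two transition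
functions. States and tape symbols are the natural numbers that occur in the table; the start
state is `0`, and so is the blank symbol. -/
structure PTM where
  rules : List Rule

/-- A configuration: state, and tape with head position. -/
structure PTM.Cfg where
  state : ℕ
  tape : Turing.Tape ℕ

namespace PTM

/-- The rule that applies in a configuration (the first one in the table, should there be more
than one), if any. -/
def ruleAt (c : PTM) (s : Cfg) : Option Rule :=
  c.rules.find? fun r => r.state == s.state && r.read == s.tape.head

/-- The machine has halted when no rule applies. -/
def Halted (c : PTM) (s : Cfg) : Prop := c.ruleAt s = none

/-- One step with coin `b`. A halted machine stays as it is. -/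
def step (c : PTM) (s : Cfg) (b : Bool) : Cfg :=
  match c.ruleAt s with
  | none => s
  | some r =>
    let a := if b then r.act₁ else r.act₀
    ⟨a.next, (s.tape.write a.write).move a.dir⟩

/-- The tape symbols for `0`, `1` and the third symbol `none` (which is `$` in inputs and `#` in
outputs). The blank is `0`. -/
def symbol : Option Bool → ℕ
  | some false => 1
  | some true => 2
  | none => 3

/-- The initial configuration: the input is on the tape, the head on its first symbol. -/
def init (inp : List (Option Bool)) : Cfg :=
  ⟨0, Turing.Tape.mk₁ (inp.map symbol)⟩

/-- The configuration after as many steps as there are coins. -/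
def run (c : PTM) (inp : List (Option Bool)) {t : ℕ} (coins : Fin t → Bool) : Cfg :=
  (List.ofFn coins).foldl c.step (init inp)

/-- The machine has halted, and the tape from the head to the right holds a representation of the
rational number `r`, followed by blanks. -/
def Outputs (c : PTM) (s : Cfg) (r : ℚ) : Prop :=
  c.Halted s ∧ ∃ out, RepresentsRat out r ∧
    s.tape.right₀ = Turing.ListBlank.mk (out.map symbol)

/-- The probability, over `t` independent fair coins, that the configuration of `c` after `t` steps
on input `inp` has the property `E`. -/
noncomputable def prob (c : PTM) (inp : List (Option Bool)) (t : ℕ) (E : Cfg → Prop) : ℝ :=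
  (Nat.card {coins : Fin t → Bool // E (c.run inp coins)} : ℝ) / 2 ^ t

/-- Binary description of a natural number, in unary with an end marker. -/
def encodeNat (n : ℕ) : List Bool := List.replicate n true ++ [false]

/-- Binary description of an action. -/
def encodeAction (a : Action) : List Bool :=
  encodeNat a.next ++ encodeNat a.write ++ [decide (a.dir = Turing.Dir.right)]

/-- Binary description of a rule. -/
def encodeRule (r : Rule) : List Bool :=
  encodeNat r.state ++ encodeNat r.read ++ encodeAction r.act₀ ++ encodeAction r.act₁

/-- Binary description of a machine. -/
def encode (c : PTM) : List Bool := c.rules.flatMap encodeRule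

theorem encodeNat_append_inj {m n : ℕ} {u v : List Bool}
    (h : encodeNat m ++ u = encodeNat n ++ v) : m = n ∧ u = v := by
  induction m generalizing n with
  | zero => cases n <;> simp_all [encodeNat, List.replicate_succ]
  | succ m ih =>
    cases n with
    | zero => simp [encodeNat, List.replicate_succ] at h
    | succ n =>
      have := @ih n (by simpa [encodeNat, List.replicate_succ] using h)
      simpa using this

theorem encodeAction_append_inj {a b : Action} {u v : List Bool}
    (h : encodeAction a ++ u = encodeAction b ++ v) : a = b ∧ u = v := by
  obtain ⟨n, w, d⟩ := a
  obtain ⟨n', w', d'⟩ := b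
  simp only [encodeAction, List.append_assoc] at h
  obtain ⟨h1, hh⟩ := encodeNat_append_inj h
  obtain ⟨h2, hd⟩ := encodeNat_append_inj hh
  cases d <;> cases d' <;> simp_all

theorem encodeRule_append_inj {a b : Rule} {u v : List Bool}
    (h : encodeRule a ++ u = encodeRule b ++ v) : a = b ∧ u = v := by
  obtain ⟨s, r, a₀, a₁⟩ := a
  obtain ⟨s', r', b₀, b₁⟩ := b
  simp only [encodeRule, List.append_assoc] at h
  obtain ⟨h1, k1⟩ := encodeNat_append_inj h
  obtain ⟨h2, k2⟩ := encodeNat_append_inj k1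
  obtain ⟨h3, k3⟩ := encodeAction_append_inj k2
  obtain ⟨h4, k4⟩ := encodeAction_append_inj k3
  exact ⟨by rw [h1, h2, h3, h4], k4⟩

theorem encodeRule_ne_nil (r : Rule) : encodeRule r ≠ [] := by
  simp [encodeRule, encodeNat]

/-- A machine is determined by its description. -/
theorem encode_injective : Function.Injective encode := by
  rintro ⟨l⟩ ⟨l'⟩ h
  simp only [encode] at h
  congr 1
  induction l generalizing l' with
  | nil => cases l' <;> simp_all [encodeRule_ne_nil]
  | cons a l ih =>
    cases l' with
    | nil => simp_all [encodeRule_ne_nil]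
    | cons b l' =>
      simp only [List.flatMap_cons] at h
      obtain ⟨h1, h2⟩ := encodeRule_append_inj h
      rw [h1, ih l' h2]

end PTM

/-! Approximate local normalization -/

/-- `r` approximates `p` to within the factor `lam`. -/
def ApproxWithin (lam : ℝ) (r : ℚ) (p : ℝ) : Prop :=
  (r : ℝ) / lam ≤ p ∧ p ≤ lam * r

/-- The deterministic machine `M` with the parameters `θ` approximates the local conditional
probabilities of `p` to within the factor `lam`, efficiently, with compact parameters, and with the
help of randomness: the length of `θ n` is polynomial in `n`; on input `θ n` the machine `M` writes
in time polynomial in `n` the description of a probabilistic machine `q n`; on every input `ya`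
with `|y| ≤ n` and `a ∈ {0, 1, $}`, every run of `q n` halts within time polynomial in `n` with
a rational number in `[0, 1]` as output; and whenever `p(a | y) > 0`, this output is, with
probability greater than `2/3`, within the factor `lam` of `p(a | y)`. -/
def ApproximatelyLocallyNormalizes (lam : ℝ) (p : WeightedLanguage)
    (M : Turing.TM2ComputableAux Bool Bool) (θ : ℕ → List Bool) : Prop :=
  ∃ (q : ℕ → PTM) (size build time : Polynomial ℕ),
    (∀ n, (θ n).length ≤ size.eval n) ∧
    (∀ n, Computes M (θ n) (q n).encode (build.eval n)) ∧
    (∀ (n : ℕ) (y : List Bool) (a : Option Bool), y.length ≤ n →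
      ∀ coins : Fin (time.eval n) → Bool, ∃ r : ℚ, 0 ≤ r ∧ r ≤ 1 ∧
        (q n).Outputs ((q n).run (y.map some ++ [a]) coins) r) ∧
    ∀ (n : ℕ) (y : List Bool) (a : Option Bool), y.length ≤ n → 0 < localProb p y a →
      2 / 3 < (q n).prob (y.map some ++ [a]) (time.eval n)
        (fun s => ∃ r : ℚ, (q n).Outputs s r ∧ ApproxWithin lam r (localProb p y a))

end LocalNorm

/-! Take `L` in NP but not in P/poly, with verifier `v`. The language `verifierWeight v` lives on
continuations of queries `y = 1ᵏ 0 1ᵐ 0 0x₁ ⋯ 0xₙ 1`. The fallback string `y0` has weight `16⁻ˡ`,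
and `y1w` has weight `4⁻ˡ` if `|w| = m` and `v` accepts `w` for `x`, where `l` is the length of the
string in question; all other strings have weight 0. There are `2ˡ` strings of length `l`, so the
total is finite. A weight is computed by parsing the string and running the verifier at most once.

The fallback makes `Z(y)` positive for every query. If `x` has no witness of length `m`, it is the
only continuation with positive weight, and `p(0 | y) = 1` (`localProb_eq_one`). If there is a
witness, one witness string already outweighs the fallback so much that `p(0 | y) ≤ 2⁻ᵏ`
(`localProb_le`). The padding `k` belongs to the query and not to the language, so a single language
defeats every `λ`: for `λ ≤ 2ʲ` take `k = 2j + 1`. Then a `λ`-approximation is at least `2⁻ʲ` for `x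
∉ L` and at most `2⁻⁽ʲ⁺¹⁾` for `x ∈ L`, a gap that shows in the leading digits of numerator and
denominator (`PTM.decode`).

An approximate local normalizer would thus decide `L` with error below `1/3`. As in Adleman's
theorem, a majority vote over `O(n)` runs errs with probability less than `2⁻ⁿ`, so some coins serve
all inputs of length `n` at once (`exists_majority`). With these coins and the machine `q`
hardwired, the vote is a circuit of polynomial size (`PTM.hasCircuit_vote`), and a fixed Turing
machine evaluates circuits given as advice (`mem_PPoly_of_circuits`). So `L` would be in P/poly
(`mem_PPoly_of_approximatelyLocallyNormalizes`). -/

namespace LocalNorm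

/-! Runs of deterministic multitape machines -/

section Reach

variable {K : Type} [DecidableEq K] {Γ : K → Type} {Λ σ : Type}

/-- The machine with program `m` gets from the configuration `a` to `b` in at most `t` steps. -/
def Reach (m : Λ → Turing.TM2.Stmt Γ Λ σ) (a : Turing.TM2.Cfg Γ Λ σ) (t : ℕ)
    (b : Turing.TM2.Cfg Γ Λ σ) : Prop :=
  ∃ k ≤ t, (flip bind (Turing.TM2.step m))^[k] (some a) = some b

variable {m : Λ → Turing.TM2.Stmt Γ Λ σ} {a b c : Turing.TM2.Cfg Γ Λ σ} {s t : ℕ}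

theorem Reach.refl (a : Turing.TM2.Cfg Γ Λ σ) (t : ℕ) : Reach m a t a :=
  ⟨0, Nat.zero_le _, rfl⟩

theorem Reach.mono (h : Reach m a s b) (hst : s ≤ t) : Reach m a t b := by
  obtain ⟨k, hk, h⟩ := h
  exact ⟨k, hk.trans hst, h⟩

theorem Reach.trans (h₁ : Reach m a s b) (h₂ : Reach m b t c) : Reach m a (s + t) c := by
  obtain ⟨k, hk, h⟩ := h₁
  obtain ⟨l, hl, h'⟩ := h₂
  refine ⟨l + k, by omega, ?_⟩
  rw [Function.iterate_add_apply, h, h']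

theorem Reach.single (h : Turing.TM2.step m a = some b) : Reach m a 1 b :=
  ⟨1, le_rfl, by simpa [flip] using h⟩

theorem Reach.head (h : Turing.TM2.step m a = some b) (h' : Reach m b t c) :
    Reach m a (t + 1) c := by
  rw [add_comm]
  exact (Reach.single h).trans h'

/-- Induction on the length of a run. -/
theorem Reach.induct {P : Turing.TM2.Cfg Γ Λ σ → ℕ → Prop} (h : Reach m a t b)
    (h0 : P a 0) (hs : ∀ c d k, P c k → Turing.TM2.step m c = some d → P d (k + 1)) :
    ∃ k ≤ t, P b k := by
  obtain ⟨k, hk, h⟩ := h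
  refine ⟨k, hk, ?_⟩
  induction k generalizing b with
  | zero => simp at h; exact h ▸ h0
  | succ k ih =>
    rw [Function.iterate_succ_apply'] at h
    cases hc : (flip bind (Turing.TM2.step m))^[k] (some a) with
    | none => rw [hc] at h; simp [flip] at h
    | some c =>
      rw [hc] at h
      exact hs c b k (ih (by omega) hc) (by simpa [flip] using h)

end Reach

theorem Reach.map {K K' : Type} [DecidableEq K] [DecidableEq K'] {Γ : K → Type} {Γ' : K' → Type}
    {Λ Λ' σ σ' : Type} {m : Λ → Turing.TM2.Stmt Γ Λ σ} {m' : Λ' → Turing.TM2.Stmt Γ' Λ' σ'}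
    (f : Turing.TM2.Cfg Γ Λ σ → Turing.TM2.Cfg Γ' Λ' σ')
    (hf : ∀ a b, Turing.TM2.step m a = some b → Turing.TM2.step m' (f a) = some (f b))
    {a b : Turing.TM2.Cfg Γ Λ σ} {t : ℕ} (h : Reach m a t b) : Reach m' (f a) t (f b) := by
  obtain ⟨k, hk, h⟩ := h.induct (P := fun c k => Reach m' (f a) k (f c)) (Reach.refl _ _)
    fun c d k hc hd => hc.trans (Reach.single (hf c d hd))
  exact h.mono hk

theorem computes_iff {A B : Type} (M : Turing.TM2ComputableAux A B) (inp : List A) (out : List B)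
    (t : ℕ) :
    Computes M inp out t ↔
      Reach M.tm.m (Turing.initList M.tm (inp.map M.inputAlphabet.invFun)) t
        (Turing.haltList M.tm (out.map M.outputAlphabet.invFun)) := by
  constructor
  · rintro ⟨⟨⟨k, h⟩, hk⟩⟩
    exact ⟨k, hk, h⟩
  · rintro ⟨k, hk, h⟩
    exact ⟨⟨⟨k, h⟩, hk⟩⟩

/-! The length of the output -/

/-- The largest number of symbols that a statement pushes. -/
def pushes {K : Type} {Γ : K → Type} {Λ σ : Type} : Turing.TM2.Stmt Γ Λ σ → ℕ
  | .push _ _ q => pushes q + 1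
  | .peek _ _ q => pushes q
  | .pop _ _ q => pushes q
  | .load _ q => pushes q
  | .branch _ q₁ q₂ => max (pushes q₁) (pushes q₂)
  | .goto _ => 0
  | .halt => 0

theorem length_stepAux_le {K : Type} [DecidableEq K] {Γ : K → Type} {Λ σ : Type}
    (q : Turing.TM2.Stmt Γ Λ σ) (v : σ) (S : ∀ k, List (Γ k)) (k : K) :
    ((Turing.TM2.stepAux q v S).stk k).length ≤ (S k).length + pushes q := by
  induction q generalizing v S with
  | push k' f q ih =>
    refine (ih _ _).trans ?_
    by_cases h : k = k'
    · subst h; simp [pushes]; omega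
    · simp [pushes, Function.update_of_ne h]
  | peek k' f q ih => exact ih _ _
  | pop k' f q ih =>
    refine (ih _ _).trans ?_
    by_cases h : k = k'
    · subst h; simp [pushes]
    · simp [pushes, Function.update_of_ne h]
  | load f q ih => exact ih _ _
  | branch f q₁ q₂ ih₁ ih₂ =>
    simp only [Turing.TM2.stepAux, pushes]
    cases f v
    · exact (ih₂ _ _).trans (by simp)
    · exact (ih₁ _ _).trans (by simp)
  | goto f => simp [pushes]
  | halt => simp [pushes]

theorem initList_stk_self (tm : Turing.FinTM2) (s : List (tm.Γ tm.k₀)) :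
    (Turing.initList tm s).stk tm.k₀ = s := by
  simp [Turing.initList]

theorem initList_stk_of_ne (tm : Turing.FinTM2) (s : List (tm.Γ tm.k₀)) {k : tm.K}
    (h : k ≠ tm.k₀) : (Turing.initList tm s).stk k = [] := by
  simp [Turing.initList, h]

theorem haltList_stk_self (tm : Turing.FinTM2) (s : List (tm.Γ tm.k₁)) :
    (Turing.haltList tm s).stk tm.k₁ = s := by
  simp [Turing.haltList]

theorem haltList_stk_of_ne (tm : Turing.FinTM2) (s : List (tm.Γ tm.k₁)) {k : tm.K}
    (h : k ≠ tm.k₁) : (Turing.haltList tm s).stk k = [] := by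
  simp [Turing.haltList, h]

theorem initList_eq (tm : Turing.FinTM2) (s : List (tm.Γ tm.k₀)) (S : ∀ k, List (tm.Γ k))
    (h : S tm.k₀ = s) (h' : ∀ k, k ≠ tm.k₀ → S k = []) :
    Turing.initList tm s = ⟨some tm.main, tm.initialState, S⟩ := by
  have : (Turing.initList tm s).stk = S := by
    funext k
    by_cases hk : k = tm.k₀
    · subst hk; rw [initList_stk_self, h]
    · rw [initList_stk_of_ne _ _ hk, h' k hk]
  rw [← this]
  rfl

theorem haltList_eq (tm : Turing.FinTM2) (s : List (tm.Γ tm.k₁)) (S : ∀ k, List (tm.Γ k))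
    (h : S tm.k₁ = s) (h' : ∀ k, k ≠ tm.k₁ → S k = []) :
    Turing.haltList tm s = ⟨none, tm.initialState, S⟩ := by
  have : (Turing.haltList tm s).stk = S := by
    funext k
    by_cases hk : k = tm.k₁
    · subst hk; rw [haltList_stk_self, h]
    · rw [haltList_stk_of_ne _ _ hk, h' k hk]
  rw [← this]
  rfl

/-- The output of a machine is at most linearly longer than its input and its running time. -/
theorem exists_length_output_le {A B : Type} (M : Turing.TM2ComputableAux A B) :
    ∃ C : ℕ, ∀ inp out t, Computes M inp out t → out.length ≤ inp.length + C * t := by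
  have := M.tm.ΛFin
  -- One step executes a whole statement, which may push several symbols; the maximum over the
  -- finitely many labels bounds the growth per step.
  refine ⟨Finset.univ.sup fun l => pushes (M.tm.m l), fun inp out t h => ?_⟩
  set C := Finset.univ.sup fun l => pushes (M.tm.m l) with hC
  rw [computes_iff] at h
  obtain ⟨k, hk, h⟩ := h.induct
    (P := fun c k => (c.stk M.tm.k₁).length ≤ inp.length + C * k) (by
      -- If input and output share a stack, the output stack starts with the input on it; hence the
      -- summand `inp.length`.
      by_cases h : M.tm.k₁ = M.tm.k₀
      · simp [Turing.initList, h]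
        generalize_proofs h1
        revert h1
        generalize hl : List.map (⇑M.inputAlphabet.symm) inp = l
        have : l.length = inp.length := by rw [← hl]; simp
        rw [← this]
        clear hl this
        revert l
        rw [h]
        simp
      · simp [initList_stk_of_ne _ _ h]) (by
      rintro ⟨l, v, S⟩ d k hc hd
      cases l with
      | none => simp at hd
      | some l =>
        simp at hd
        subst hd
        have h1 := length_stepAux_le (M.tm.m l) v S M.tm.k₁
        have h2 : pushes (M.tm.m l) ≤ C := Finset.le_sup (f := fun l => pushes (M.tm.m l))
          (Finset.mem_univ l)
        simp only at hc
        rw [mul_add]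
        convert h1.trans (by omega : _ ≤ inp.length + (C * k + C * 1)))
  rw [haltList_stk_self] at h
  simp at h
  exact h.trans (by gcongr)

theorem eval_mono_nat (p : Polynomial ℕ) : Monotone fun n => p.eval n := by
  intro a b h
  simp only [Polynomial.eval_eq_sum, Polynomial.sum]
  gcongr

/-! Boolean circuits, and a machine that evaluates them -/

/-- A circuit is a list of NAND gates. A gate `(i, j)` reads the `i`-th and the `j`-th most recent
wire and puts its result on a new wire. -/
def evalGates (gs : List (ℕ × ℕ)) (ws : List Bool) : List Bool :=
  gs.foldl (fun ws g => (!(ws.getD g.1 false && ws.getD g.2 false)) :: ws) ws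

@[simp] theorem evalGates_nil (ws : List Bool) : evalGates [] ws = ws := rfl

theorem evalGates_cons (g : ℕ × ℕ) (gs : List (ℕ × ℕ)) (ws : List Bool) :
    evalGates (g :: gs) ws =
      evalGates gs ((!(ws.getD g.1 false && ws.getD g.2 false)) :: ws) := rfl

theorem evalGates_append (gs hs : List (ℕ × ℕ)) (ws : List Bool) :
    evalGates (gs ++ hs) ws = evalGates hs (evalGates gs ws) := by
  simp [evalGates]

theorem length_evalGates (gs : List (ℕ × ℕ)) (ws : List Bool) :
    (evalGates gs ws).length = gs.length + ws.length := by
  induction gs generalizing ws with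
  | nil => simp
  | cons g gs ih => rw [evalGates_cons, ih]; simp; omega

namespace Evaluator

/-- The stacks: the input, the program, and the wires to the left and to the right of a cursor. -/
inductive Stack
  | inp | prog | lft | rgt
  deriving DecidableEq

instance : Fintype Stack :=
  ⟨{.inp, .prog, .lft, .rgt}, fun k => by cases k <;> simp⟩

/-- The stack alphabets. -/
@[reducible] def Alphabet : Stack → Type
  | .inp => Option Bool
  | _ => Bool

/-- The labels. -/
inductive Label
  | advice | input | exec | clear
  deriving DecidableEq

instance : Fintype Label :=
  ⟨{.advice, .input, .exec, .clear}, fun k => by cases k <;> simp⟩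

/-- The registers. -/
structure Reg where
  sym : Option (Option Bool)
  b₁ : Option Bool
  b₂ : Option Bool
  wire : Option Bool
  r₀ : Bool
  r₁ : Bool
  deriving Fintype

/-- The registers, with all but two of them empty. -/
def reg (r₀ r₁ : Bool) : Reg := ⟨none, none, none, none, r₀, r₁⟩

open Turing.TM2.Stmt

/-- The end of every step: empty the scratch registers and go to `l`. -/
def jump (l : Label) : Turing.TM2.Stmt Alphabet Label Reg :=
  load (fun s => reg s.r₀ s.r₁) <| goto fun _ => l

/-- The program. -/
def program : Label → Turing.TM2.Stmt Alphabet Label Reg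
  | .advice =>
    pop .inp (fun s a => { s with sym := a }) <|
    branch (fun s => s.sym == some none)
      -- The separator leaves behind the constant wire `true`, which lies below all the inputs.
      (push .rgt (fun _ => true) <| jump .input)
      (push .prog (fun s => s.sym.join.getD false) <| jump .advice)
  | .input =>
    pop .inp (fun s a => { s with sym := a }) <|
    branch (fun s => s.sym.isSome)
      (push .rgt (fun s => s.sym.join.getD false) <| jump .input)
      (jump .exec)
  | .exec =>
    pop .prog (fun s a => { s with b₁ := a }) <|
    pop .prog (fun s a => { s with b₂ := a }) <|
    branch (fun s => s.b₁.isNone)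
      (pop .rgt (fun s a => { s with r₀ := a.getD false }) <| jump .clear) <|
    -- Two-bit instructions: 00 moves the cursor right, 01 moves it left, 10 loads the wire at the
    -- cursor into `r₀` and shifts `r₀` to `r₁`, 11 puts the NAND of the two registers on a new
    -- wire.
    branch (fun s => s.b₁ == some false)
      (branch (fun s => s.b₂ == some false)
        (pop .rgt (fun s a => { s with wire := a }) <|
         branch (fun s => s.wire.isSome)
          (push .lft (fun s => s.wire.getD false) <| jump .exec)
          (jump .exec))
        (pop .lft (fun s a => { s with wire := a }) <|
         branch (fun s => s.wire.isSome)
          (push .rgt (fun s => s.wire.getD false) <| jump .exec)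
          (jump .exec)))
      (branch (fun s => s.b₂ == some false)
        (peek .rgt (fun s a => { s with r₀ := a.getD false, r₁ := s.r₀ }) <| jump .exec)
        (push .rgt (fun s => !(s.r₁ && s.r₀)) <| jump .exec))
  | .clear =>
    pop .rgt (fun s a => { s with wire := a }) <|
    branch (fun s => s.wire.isSome)
      (jump .clear)
      (push .lft (fun s => s.r₀) <| load (fun _ => reg false false) halt)

/-- The machine. -/
def machine : Turing.TM2ComputableAux (Option Bool) Bool where
  tm :=
    { K := Stack
      k₀ := .inp
      k₁ := .lft
      Γ := Alphabet
      Λ := Label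
      main := .advice
      σ := Reg
      initialState := reg false false
      Γk₀Fin := inferInstanceAs (Fintype (Option Bool))
      m := program }
  inputAlphabet := Equiv.refl _
  outputAlphabet := Equiv.refl _

/-- The contents of the stacks. -/
def store (a : List (Option Bool)) (p l r : List Bool) : ∀ k, List (Alphabet k)
  | .inp => a
  | .prog => p
  | .lft => l
  | .rgt => r

section
variable (a a' : List (Option Bool)) (p p' l l' r r' : List Bool)

@[simp] theorem store_inp : store a p l r .inp = a := rfl
@[simp] theorem store_prog : store a p l r .prog = p := rfl
@[simp] theorem store_lft : store a p l r .lft = l := rfl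
@[simp] theorem store_rgt : store a p l r .rgt = r := rfl

@[simp] theorem update_inp :
    Function.update (store a p l r) .inp a' = store a' p l r := by
  funext k; cases k <;> rfl
@[simp] theorem update_prog :
    Function.update (store a p l r) .prog p' = store a p' l r := by
  funext k; cases k <;> rfl
@[simp] theorem update_lft :
    Function.update (store a p l r) .lft l' = store a p l' r := by
  funext k; cases k <;> rfl
@[simp] theorem update_rgt :
    Function.update (store a p l r) .rgt r' = store a p l r' := by
  funext k; cases k <;> rfl

end

/-- A running configuration. -/
def cfg (lab : Label) (r₀ r₁ : Bool) (a : List (Option Bool)) (p l r : List Bool) :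
    Turing.TM2.Cfg Alphabet Label Reg :=
  ⟨some lab, reg r₀ r₁, store a p l r⟩

theorem reach_advice (u v : List (Option Bool)) (w : List Bool) (p l r : List Bool) (r₀ r₁ : Bool)
    (hu : u = w.map some) :
    Reach program (cfg .advice r₀ r₁ (u ++ none :: v) p l r) (w.length + 1)
      (cfg .input r₀ r₁ v (w.reverse ++ p) l (true :: r)) := by
  subst hu
  induction w generalizing p with
  | nil => exact Reach.single (by simp [cfg, program, jump, reg])
  | cons b w ih =>
    refine Reach.head (b := cfg .advice r₀ r₁ (w.map some ++ none :: v) (b :: p) l r) ?_ ?_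
    · simp [cfg, program, jump, reg]
    · simpa using ih (b :: p)

theorem reach_input (x p l r : List Bool) (r₀ r₁ : Bool) :
    Reach program (cfg .input r₀ r₁ (x.map some) p l r) (x.length + 1)
      (cfg .exec r₀ r₁ [] p l (x.reverse ++ r)) := by
  induction x generalizing r with
  | nil => exact Reach.single (by simp [cfg, program, jump, reg])
  | cons b w ih =>
    refine Reach.head (b := cfg .input r₀ r₁ (w.map some) p l (b :: r)) ?_ ?_
    · simp [cfg, program, jump, reg]
    · simpa using ih (b :: r)

/-- `Computes` demands a final configuration with initial registers and all stacks empty except the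
output, so the leftover wires have to be removed. -/
theorem reach_clear (r : List Bool) (r₀ r₁ : Bool) :
    Reach program (cfg .clear r₀ r₁ [] [] [] r) (r.length + 1)
      ⟨none, reg false false, store [] [] [r₀] []⟩ := by
  induction r with
  | nil => exact Reach.single (by simp [cfg, program, jump, reg])
  | cons b w ih =>
    refine Reach.head (b := cfg .clear r₀ r₁ [] [] [] w) ?_ ih
    simp [cfg, program, jump, reg]

/-- Moving the cursor to the right `i` times. -/
def right (i : ℕ) : List Bool := (List.replicate i [false, false]).flatten

/-- Moving the cursor to the left `i` times. -/
def left (i : ℕ) : List Bool := (List.replicate i [false, true]).flatten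

theorem reach_right (i : ℕ) (p l r : List Bool) (r₀ r₁ : Bool) :
    Reach program (cfg .exec r₀ r₁ [] (right i ++ p) l r) i
      (cfg .exec r₀ r₁ [] p ((r.take i).reverse ++ l) (r.drop i)) := by
  induction i generalizing l r with
  | zero => exact Reach.refl _ _
  | succ i ih =>
    cases r with
    | nil =>
      refine Reach.head ?_ (by simpa using ih l [])
      simp [cfg, program, jump, reg, right, List.replicate_succ]
    | cons b r =>
      refine Reach.head ?_ (by simpa using ih (b :: l) r)
      simp [cfg, program, jump, reg, right, List.replicate_succ]

theorem reach_left (i : ℕ) (p l r : List Bool) (r₀ r₁ : Bool) :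
    Reach program (cfg .exec r₀ r₁ [] (left i ++ p) l r) i
      (cfg .exec r₀ r₁ [] p (l.drop i) ((l.take i).reverse ++ r)) := by
  induction i generalizing l r with
  | zero => exact Reach.refl _ _
  | succ i ih =>
    cases l with
    | nil =>
      refine Reach.head ?_ (by simpa using ih [] r)
      simp [cfg, program, jump, reg, left, List.replicate_succ]
    | cons b l =>
      refine Reach.head ?_ (by simpa using ih l (b :: r))
      simp [cfg, program, jump, reg, left, List.replicate_succ]

/-- Loading the `i`-th wire into a register. -/
def fetch (i : ℕ) : List Bool := right i ++ ([true, false] ++ left i)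

/-- The way to wire `i` moves the wires above it to `lft`, and the way back restores them. An index
past the last wire reads `false`. -/
theorem reach_fetch (i : ℕ) (p r : List Bool) (r₀ r₁ : Bool) :
    Reach program (cfg .exec r₀ r₁ [] (fetch i ++ p) [] r) (2 * i + 1)
      (cfg .exec (r.getD i false) r₀ [] p [] r) := by
  have h1 := reach_right i ([true, false] ++ left i ++ p) [] r r₀ r₁
  have h2 : Reach program
      (cfg .exec r₀ r₁ [] ([true, false] ++ left i ++ p) ((r.take i).reverse ++ []) (r.drop i)) 1
      (cfg .exec (r.getD i false) r₀ [] (left i ++ p) ((r.take i).reverse ++ []) (r.drop i)) :=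
    Reach.single (by simp [cfg, program, jump, reg, List.head?_drop])
  have h3 := reach_left i p ((r.take i).reverse ++ []) (r.drop i) (r.getD i false) r₀
  have h4 : ((r.take i).reverse ++ []).drop i = [] := by simp
  have h5 : (((r.take i).reverse ++ []).take i).reverse ++ r.drop i = r := by
    rw [List.append_nil, List.take_of_length_le (by simp)]
    simp
  rw [h4, h5] at h3
  have := (h1.trans h2).trans h3
  simp only [fetch, List.append_assoc] at this ⊢
  exact this.mono (by omega)

/-- The code of a gate. -/
def gateCode (g : ℕ × ℕ) : List Bool := fetch g.1 ++ (fetch g.2 ++ [true, true])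

/-- The code of a circuit. -/
def code (gs : List (ℕ × ℕ)) : List Bool := gs.flatMap gateCode

theorem reach_gate (g : ℕ × ℕ) (p r : List Bool) (r₀ r₁ : Bool) :
    Reach program (cfg .exec r₀ r₁ [] (gateCode g ++ p) [] r) (2 * g.1 + 2 * g.2 + 3)
      (cfg .exec (r.getD g.2 false) (r.getD g.1 false) [] p []
        ((!(r.getD g.1 false && r.getD g.2 false)) :: r)) := by
  have h1 := reach_fetch g.1 (fetch g.2 ++ ([true, true] ++ p)) r r₀ r₁
  have h2 := reach_fetch g.2 ([true, true] ++ p) r (r.getD g.1 false) r₀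
  have h3 : Reach program
      (cfg .exec (r.getD g.2 false) (r.getD g.1 false) [] ([true, true] ++ p) [] r) 1
      (cfg .exec (r.getD g.2 false) (r.getD g.1 false) [] p []
        ((!(r.getD g.1 false && r.getD g.2 false)) :: r)) :=
    Reach.single (by simp [cfg, program, jump, reg])
  have := (h1.trans h2).trans h3
  simp only [gateCode, List.append_assoc] at this ⊢
  exact this.mono (by omega)

theorem length_gateCode (g : ℕ × ℕ) : (gateCode g).length = 4 * g.1 + 4 * g.2 + 6 := by
  simp [gateCode, fetch, right, left]; omega

theorem reach_code (gs : List (ℕ × ℕ)) (r : List Bool) (r₀ r₁ : Bool) :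
    ∃ r₀' r₁', Reach program (cfg .exec r₀ r₁ [] (code gs) [] r) (code gs).length
      (cfg .exec r₀' r₁' [] [] [] (evalGates gs r)) := by
  induction gs generalizing r r₀ r₁ with
  | nil => exact ⟨_, _, Reach.refl _ _⟩
  | cons g gs ih =>
    obtain ⟨r₀', r₁', h⟩ := ih ((!(r.getD g.1 false && r.getD g.2 false)) :: r)
      (r.getD g.2 false) (r.getD g.1 false)
    refine ⟨r₀', r₁', ?_⟩
    have := (reach_gate g (code gs) r r₀ r₁).trans h
    simp only [code, List.flatMap_cons, evalGates_cons] at this ⊢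
    refine this.mono ?_
    have := length_gateCode g
    simp only [List.length_append]
    omega

theorem length_code_le (gs : List (ℕ × ℕ)) (B : ℕ) (h : ∀ g ∈ gs, g.1 ≤ B ∧ g.2 ≤ B) :
    (code gs).length ≤ gs.length * (8 * B + 6) := by
  induction gs with
  | nil => simp [code]
  | cons g gs ih =>
    have h1 := ih fun g hg => h g (List.mem_cons_of_mem _ hg)
    have h2 := h g List.mem_cons_self
    have h3 := length_gateCode g
    simp only [code, List.flatMap_cons, List.length_append, List.length_cons] at h1 ⊢
    rw [add_mul, one_mul]
    omega

theorem computes (gs : List (ℕ × ℕ)) (x : List Bool) :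
    Computes machine (pairEnc (code gs).reverse x)
      [(evalGates gs (x.reverse ++ [true])).headD false]
      (2 * (code gs).length + 2 * x.length + gs.length + 6) := by
  rw [computes_iff]
  have hi : Turing.initList machine.tm ((pairEnc (code gs).reverse x).map
      machine.inputAlphabet.invFun) =
      cfg .advice false false (pairEnc (code gs).reverse x) [] [] [] := by
    refine initList_eq machine.tm _ _ (by simp [machine]) ?_
    rintro (_ | _ | _ | _) hk <;> first | rfl | exact absurd rfl hk
  have hh : Turing.haltList machine.tm
      (([(evalGates gs (x.reverse ++ [true])).headD false]).map machine.outputAlphabet.invFun) =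
      ⟨none, reg false false,
        store [] [] [(evalGates gs (x.reverse ++ [true])).headD false] []⟩ := by
    refine haltList_eq machine.tm _ _ (by simp [machine]) ?_
    rintro (_ | _ | _ | _) hk <;> first | rfl | exact absurd rfl hk
  rw [hi, hh]
  have h1 := reach_advice _ (x.map some) (code gs).reverse [] [] [] false false rfl
  have h2 := reach_input x ((code gs).reverse.reverse ++ []) [] [true] false false
  rw [List.reverse_reverse, List.append_nil] at h1 h2
  obtain ⟨r₀, r₁, h3⟩ := reach_code gs (x.reverse ++ [true]) false false
  have h4 : Reach program (cfg .exec r₀ r₁ [] [] [] (evalGates gs (x.reverse ++ [true]))) 1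
      (cfg .clear ((evalGates gs (x.reverse ++ [true])).headD false) r₁ [] [] []
        (evalGates gs (x.reverse ++ [true])).tail) :=
    Reach.single (by simp [cfg, program, jump, reg])
  have h5 := reach_clear (evalGates gs (x.reverse ++ [true])).tail
    ((evalGates gs (x.reverse ++ [true])).headD false) r₁
  refine ((((h1.trans h2).trans h3).trans h4).trans h5).mono ?_
  simp [length_evalGates]
  omega

end Evaluator

open Classical in
/-- A language that has circuits of polynomial size is in P/poly. -/
theorem mem_PPoly_of_circuits (L : Language Bool) (s : Polynomial ℕ)
    (h : ∀ n, ∃ gs : List (ℕ × ℕ), gs.length ≤ s.eval n ∧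
      (∀ g ∈ gs, g.1 ≤ n + gs.length ∧ g.2 ≤ n + gs.length) ∧
      ∀ x : List Bool, x.length = n →
        ((evalGates gs (x.reverse ++ [true])).headD false = true ↔ x ∈ L)) :
    L ∈ PPoly := by
  choose gs h1 h2 h3 using h
  have hlen : ∀ n, (Evaluator.code (gs n)).length ≤
      (s * (8 * (Polynomial.X + s) + 6)).eval n := by
    intro n
    refine (Evaluator.length_code_le (gs n) (n + s.eval n) fun g hg => ?_).trans ?_
    · have := h2 n g hg
      have := h1 n
      omega
    · simp
      exact h1 n
  -- Moving the advice from the input stack to the program stack reverses it.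
  refine ⟨Evaluator.machine, fun n => (Evaluator.code (gs n)).reverse,
    s * (8 * (Polynomial.X + s) + 6),
    2 * (s * (8 * (Polynomial.X + s) + 6)) + 2 * Polynomial.X + s + 6,
    fun n => by simpa using hlen n, fun x => ?_⟩
  have hc := Evaluator.computes (gs x.length) x
  have he : (evalGates (gs x.length) (x.reverse ++ [true])).headD false = decide (x ∈ L) := by
    rw [Bool.eq_iff_iff, h3 x.length x rfl]
    simp
  rw [he] at hc
  rw [computes_iff] at hc ⊢
  refine hc.mono ?_
  have := hlen x.length
  have := h1 x.length
  simp only [Polynomial.eval_add, Polynomial.eval_mul, Polynomial.eval_X,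
    Polynomial.eval_ofNat] at *
  omega

/-! Sets of functions computed by small circuits -/

/-- Some circuit of size `s` with `n` inputs computes all functions in `S`. -/
def HasCircuit (n s : ℕ) (S : Set ((Fin n → Bool) → Bool)) : Prop :=
  ∃ gs : List (ℕ × ℕ), gs.length ≤ s ∧
    (∀ g ∈ gs, g.1 ≤ n + gs.length ∧ g.2 ≤ n + gs.length) ∧
    ∀ f ∈ S, ∃ i ≤ n + gs.length, ∀ x : Fin n → Bool,
      (evalGates gs ((List.ofFn x).reverse ++ [true])).getD i false = f x

/-- `f` is a NAND formula of size at most `k` in the functions in `S` and the constant `true`. -/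
inductive Formula {X : Type} (S : Set (X → Bool)) : ℕ → (X → Bool) → Prop
  | base {k f} : f ∈ S → Formula S k f
  | true {k} : Formula S k (fun _ => true)
  | nand {a b k f g} : Formula S a f → Formula S b g → a + b + 1 ≤ k →
      Formula S k (fun x => !(f x && g x))

/-! ### Boolean connectives as NAND formulas -/

namespace Formula

variable {X : Type} {S S' : Set (X → Bool)} {a b k l : ℕ} {f g c : X → Bool}

theorem mono (h : Formula S k f) (hk : k ≤ l) : Formula S l f := by
  cases h with
  | base h => exact .base h
  | true => exact .true
  | nand h1 h2 h3 => exact .nand h1 h2 (h3.trans hk)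

theorem subset (h : Formula S k f) (hS : S ⊆ S') : Formula S' k f := by
  induction h with
  | base h => exact .base (hS h)
  | true => exact .true
  | nand _ _ h3 h1 h2 => exact .nand h1 h2 h3

theorem not (h : Formula S a f) : Formula S (a + 1) (fun x => !f x) := by
  simpa using Formula.nand h (.true (k := 0)) le_rfl

theorem const (b : Bool) : Formula S 1 (fun _ => b) := by
  cases b
  · exact Formula.not (.true (k := 0))
  · exact .true

theorem and (h : Formula S a f) (h' : Formula S b g) :
    Formula S (a + b + 2) (fun x => f x && g x) := by
  simpa using (Formula.nand h h' le_rfl).not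

theorem or (h : Formula S a f) (h' : Formula S b g) :
    Formula S (a + b + 3) (fun x => f x || g x) := by
  have := Formula.nand h.not h'.not (k := a + b + 3) (by omega)
  simpa using this

theorem ite (hc : Formula S k c) (h : Formula S a f) (h' : Formula S b g) :
    Formula S (2 * k + a + b + 8) (fun x => bif c x then f x else g x) := by
  have := ((hc.and h).or (hc.not.and h')).mono (l := 2 * k + a + b + 8) (by omega)
  convert this using 2 with x
  cases c x <;> simp

theorem any {ι : Type} (l : List ι) (F : ι → X → Bool) (h : ∀ i ∈ l, Formula S k (F i)) :
    Formula S (l.length * (k + 3) + 1) (fun x => l.any fun i => F i x) := by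
  induction l with
  | nil => exact (const (S := S) false).mono (by simp)
  | cons i l ih =>
    have := ((h i (by simp)).or (ih fun j hj => h j (by simp [hj]))).mono
      (l := (i :: l).length * (k + 3) + 1) (by simp; ring_nf; omega)
    simpa using this

theorem all {ι : Type} (l : List ι) (F : ι → X → Bool) (h : ∀ i ∈ l, Formula S k (F i)) :
    Formula S (l.length * (k + 4) + 2) (fun x => l.all fun i => F i x) := by
  have := (any l (fun i x => !F i x) fun i hi => (h i hi).not).not
  simpa [List.not_any_eq_all_not, add_assoc] using this

end Formula

/-! ### Extending circuits by formulas -/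

namespace HasCircuit

variable {n s t : ℕ} {S S' : Set ((Fin n → Bool) → Bool)}

theorem mono (h : HasCircuit n s S) (hs : s ≤ t) : HasCircuit n t S := by
  obtain ⟨gs, h1, h2⟩ := h
  exact ⟨gs, h1.trans hs, h2⟩

theorem subset (h : HasCircuit n s S) (hS : S' ⊆ S) : HasCircuit n s S' := by
  obtain ⟨gs, h1, h2, h3⟩ := h
  exact ⟨gs, h1, h2, fun f hf => h3 f (hS hf)⟩

/-- The constant wire is at the bottom, so its index is `n + gs.length`, whatever the gates do. -/
theorem insert_true (h : HasCircuit n s S) : HasCircuit n s (insert (fun _ => true) S) := by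
  obtain ⟨gs, h1, h2, h3⟩ := h
  refine ⟨gs, h1, h2, ?_⟩
  rintro f (rfl | hf)
  · refine ⟨n + gs.length, le_rfl, fun x => ?_⟩
    suffices h : ∀ (gs : List (ℕ × ℕ)) (ws : List Bool),
        (evalGates gs (ws ++ [true])).getD (ws.length + gs.length) false = true by
      simpa using h gs (List.ofFn x).reverse
    intro gs
    induction gs with
    | nil => simp
    | cons g gs ih =>
      intro ws
      rw [evalGates_cons]
      generalize (!((ws ++ [true]).getD g.1 false && (ws ++ [true]).getD g.2 false)) = b
      have := ih (b :: ws)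
      rw [← List.cons_append]
      convert this using 2
      simp
      omega
  · exact h3 f hf

theorem nand (h : HasCircuit n s S) {f g : (Fin n → Bool) → Bool} (hf : f ∈ S) (hg : g ∈ S) :
    HasCircuit n (s + 1) (insert (fun x => !(f x && g x)) S) := by
  obtain ⟨gs, h1, h2, h3⟩ := h
  obtain ⟨i, hi, hfi⟩ := h3 f hf
  obtain ⟨j, hj, hgj⟩ := h3 g hg
  have he : ∀ ws, evalGates (gs ++ [(i, j)]) ws =
      (!((evalGates gs ws).getD i false && (evalGates gs ws).getD j false)) ::
        evalGates gs ws := by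
    intro ws
    rw [evalGates_append, evalGates_cons, evalGates_nil]
  refine ⟨gs ++ [(i, j)], by simpa using h1, ?_, ?_⟩
  · intro g hg
    simp only [List.mem_append, List.mem_singleton, List.length_append, List.length_singleton]
      at hg ⊢
    rcases hg with hg | rfl
    · have := h2 g hg
      omega
    · constructor <;> simp only <;> omega
  · rintro f' (rfl | hf')
    · refine ⟨0, Nat.zero_le _, fun x => ?_⟩
      rw [he, List.getD_cons_zero, hfi, hgj]
    · obtain ⟨l, hl, h⟩ := h3 f' hf'
      refine ⟨l + 1, by simp; omega, fun x => ?_⟩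
      rw [he, List.getD_cons_succ, h]

theorem insert_formula (h : HasCircuit n s S) {k : ℕ} {f : (Fin n → Bool) → Bool}
    (hf : Formula S k f) : HasCircuit n (s + k) (insert f S) := by
  -- The second subformula is built on top of the circuit for the first, so the induction has to
  -- allow more available functions than `S`.
  suffices H : ∀ (T : Set ((Fin n → Bool) → Bool)) (s : ℕ), S ⊆ T → HasCircuit n s T →
      HasCircuit n (s + k) (insert f T) from H S s subset_rfl h
  clear h
  induction hf with
  | base h =>
    intro T s hT hs
    rw [Set.insert_eq_of_mem (hT h)]
    exact hs.mono (by omega)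
  | true =>
    intro T s hT hs
    exact hs.insert_true.mono (by omega)
  | @nand a b k f g h1 h2 h3 ih1 ih2 =>
    intro T s hT hs
    have h4 := ih1 T s hT hs
    have h5 := ih2 _ _ (hT.trans (Set.subset_insert _ _)) h4
    have h6 := h5.nand (f := f) (g := g) (by simp) (by simp)
    refine (h6.mono (by omega)).subset ?_
    intro x hx
    simp at hx ⊢
    tauto

theorem union_formulas (h : HasCircuit n s S) {k : ℕ} (F : List ((Fin n → Bool) → Bool))
    (hF : ∀ f ∈ F, Formula S k f) : HasCircuit n (s + F.length * k) (S ∪ {f | f ∈ F}) := by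
  induction F with
  | nil => simpa using h
  | cons f F ih =>
    have h1 := (ih fun g hg => hF g (by simp [hg])).insert_formula
      ((hF f (by simp)).subset Set.subset_union_left)
    refine (h1.mono (by simp; ring_nf; omega)).subset ?_
    intro x hx
    simp at hx ⊢
    tauto

/-- The inputs. -/
def inputs (n : ℕ) : Set ((Fin n → Bool) → Bool) := {f | ∃ i, f = fun x => x i}

theorem of_inputs (n : ℕ) : HasCircuit n 0 (inputs n) := by
  refine ⟨[], le_rfl, by simp, ?_⟩
  rintro f ⟨i, rfl⟩
  -- The input lies reversed on the wires, with its last bit as the most recent wire.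
  refine ⟨n - 1 - i, by simp; omega, fun x => ?_⟩
  have hi := i.isLt
  rw [evalGates_nil, List.getD_append _ _ _ _ (by simp; omega),
    List.getD_eq_getElem _ _ (by simp; omega),
    List.getElem_reverse]
  simp
  congr 1
  ext
  simp
  omega

/-- A circuit whose most recent wire is the value of a given function. -/
theorem exists_head (h : HasCircuit n s S) {f : (Fin n → Bool) → Bool} (hf : f ∈ S) :
    ∃ gs : List (ℕ × ℕ), gs.length ≤ s + 2 ∧
      (∀ g ∈ gs, g.1 ≤ n + gs.length ∧ g.2 ≤ n + gs.length) ∧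
      ∀ x : Fin n → Bool, (evalGates gs ((List.ofFn x).reverse ++ [true])).headD false = f x := by
  obtain ⟨gs, h1, h2, h3⟩ := h
  obtain ⟨i, hi, hfi⟩ := h3 f hf
  -- A double negation copies wire `i` to the top.
  refine ⟨gs ++ [(i, i), (0, 0)], by simpa using h1, ?_, fun x => ?_⟩
  · intro g hg
    simp only [List.mem_append, List.length_append, List.length_cons, List.length_nil,
      List.mem_cons, List.not_mem_nil, or_false] at hg ⊢
    rcases hg with hg | rfl | rfl
    · have := h2 g hg
      omega
    · constructor <;> simp only <;> omega
    · constructor <;> simp only <;> omega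
  · rw [evalGates_append, evalGates_cons, evalGates_cons, evalGates_nil, hfi]
    simp

end HasCircuit

/-! Circuits that simulate a probabilistic machine with fixed coins -/

namespace PTM

variable {X : Type}

/-- The machine is in state `q`. -/
def stateBit (q : ℕ) (s : Cfg) : Bool := s.state == q

/-- The cell at distance `i` from the head contains `b`. -/
def cellBit (i : ℤ) (b : ℕ) (s : Cfg) : Bool := s.tape.nth i == b

/-- The relevant tape symbols. -/
def symbols (c : PTM) : List ℕ := c.rules.map Rule.read ++ [0, 1, 2, 3]

/-- What there is to know about a configuration: whether it is in one of the states of the machine,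
and which symbols are in the cells at distance at most `W` from the head. -/
def features (c : PTM) (W : ℕ) : List (Cfg → Bool) :=
  c.rules.map (fun r => stateBit r.state) ++
    (List.range (2 * W + 1)).flatMap fun i : ℕ => c.symbols.map (cellBit ((i : ℤ) - W))

theorem length_features (c : PTM) (W : ℕ) :
    (c.features W).length = c.rules.length + (2 * W + 1) * (c.rules.length + 4) := by
  simp [features, symbols, List.length_flatMap]

theorem stateBit_mem_features {c : PTM} {r : Rule} (hr : r ∈ c.rules) (W : ℕ) :
    stateBit r.state ∈ c.features W := by
  simp only [features, List.mem_append, List.mem_map]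
  exact .inl ⟨r, hr, rfl⟩

theorem cellBit_mem_features {c : PTM} {i : ℤ} {W b : ℕ} (hi : |i| ≤ W) (hb : b ∈ c.symbols) :
    cellBit i b ∈ c.features W := by
  simp only [features, List.mem_append, List.mem_flatMap, List.mem_map, List.mem_range]
  rw [abs_le] at hi
  refine .inr ⟨(i + W).toNat, by omega, b, hb, ?_⟩
  congr 1
  omega

theorem mem_features {c : PTM} {W : ℕ} {f : Cfg → Bool} (h : f ∈ c.features W) :
    (∃ r ∈ c.rules, f = stateBit r.state) ∨
      ∃ i : ℤ, ∃ b ∈ c.symbols, |i| ≤ W ∧ f = cellBit i b := by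
  simp only [features, List.mem_append, List.mem_flatMap, List.mem_map, List.mem_range] at h
  rcases h with ⟨r, hr, rfl⟩ | ⟨i, hi, b, hb, rfl⟩
  · exact .inl ⟨r, hr, rfl⟩
  · exact .inr ⟨_, b, hb, by rw [abs_le]; omega, rfl⟩

/-- The features of the configurations `cfg x`, as functions of `x`. -/
def featureSet (c : PTM) (W : ℕ) (cfg : X → Cfg) : Set (X → Bool) :=
  {f | f ∈ (c.features W).map fun g x => g (cfg x)}

theorem mem_featureSet {c : PTM} {W : ℕ} {cfg : X → Cfg} {g : Cfg → Bool}
    (h : g ∈ c.features W) : (fun x => g (cfg x)) ∈ c.featureSet W cfg := by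
  simp only [featureSet, Set.mem_ofPred_eq, List.mem_map]
  exact ⟨g, h, rfl⟩

/-- What a rule does to a configuration. -/
def fire (r : Rule) (b : Bool) (s : Cfg) : Cfg :=
  ⟨(if b then r.act₁ else r.act₀).next,
    (s.tape.write (if b then r.act₁ else r.act₀).write).move (if b then r.act₁ else r.act₀).dir⟩

theorem step_eq (c : PTM) (s : Cfg) (b : Bool) :
    c.step s b = match c.ruleAt s with
      | none => s
      | some r => fire r b s := rfl

/-- Cells are numbered relative to the head, so a move shifts all indices by one, and a new cell is
either the one just written or an old neighbour. The head position never has to be tracked; the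
visible window just loses one cell on each side per step. -/
theorem nth_fire (r : Rule) (b : Bool) (i : ℤ) :
    (∃ w, ∀ s, (fire r b s).tape.nth i = w) ∨
      ∃ j : ℤ, |j| ≤ |i| + 1 ∧ ∀ s, (fire r b s).tape.nth i = s.tape.nth j := by
  generalize ha : (if b then r.act₁ else r.act₀) = a
  obtain ⟨n, w, d⟩ := a
  cases d with
  | left =>
    by_cases h : i - 1 = 0
    · exact .inl ⟨w, fun s => by simp [fire, ha, h, Turing.Tape.write]⟩
    · exact .inr ⟨i - 1, by have := abs_sub i 1; simpa using this,
        fun s => by simp [fire, ha, h]⟩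
  | right =>
    by_cases h : i + 1 = 0
    · exact .inl ⟨w, fun s => by simp [fire, ha, h, Turing.Tape.write]⟩
    · exact .inr ⟨i + 1, by have := abs_add_le i 1; simpa using this,
        fun s => by simp [fire, ha, h]⟩

/-- Searching the table is a chain of conditionals. One of them, with a test of size 2 and a branch
of size 1, adds `2 * 2 + 1 + 8 = 13` to the size. -/
theorem formula_step_aux {S : Set (X → Bool)} (cfg : X → Cfg) (b : Bool) (P : Cfg → Bool)
    (rs : List Rule)
    (hm : ∀ r ∈ rs, Formula S 2 fun x => r.state == (cfg x).state && r.read == (cfg x).tape.head)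
    (hP : Formula S 1 fun x => P (cfg x))
    (hf : ∀ r ∈ rs, Formula S 1 fun x => P (fire r b (cfg x))) :
    Formula S (rs.length * 13 + 1) fun x =>
      P (match rs.find? (fun r => r.state == (cfg x).state && r.read == (cfg x).tape.head) with
        | none => cfg x
        | some r => fire r b (cfg x)) := by
  induction rs with
  | nil => simpa using hP
  | cons r rs ih =>
    have h1 := Formula.ite (hm r (by simp)) (hf r (by simp))
      (ih (fun r hr => hm r (by simp [hr])) fun r hr => hf r (by simp [hr]))
    have h2 := h1.mono (l := (r :: rs).length * 13 + 1) (by simp; omega)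
    convert h2 using 2 with x
    rw [List.find?_cons]
    cases r.state == (cfg x).state && r.read == (cfg x).tape.head <;> rfl

theorem formula_step {c : PTM} {W : ℕ} (cfg : X → Cfg) (b : Bool) {f : X → Bool}
    (hf : f ∈ c.featureSet W fun x => c.step (cfg x) b) :
    Formula (c.featureSet (W + 1) cfg) (c.rules.length * 13 + 1) f := by
  simp only [featureSet, Set.mem_ofPred_eq, List.mem_map] at hf
  obtain ⟨g, hg, rfl⟩ := hf
  refine formula_step_aux cfg b g c.rules (fun r hr => ?_) ?_ fun r hr => ?_
  · have h1 : Formula (c.featureSet (W + 1) cfg) 0 _ :=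
      .base (mem_featureSet (stateBit_mem_features hr (W + 1)))
    have h2 : Formula (c.featureSet (W + 1) cfg) 0 _ :=
      .base (mem_featureSet (cellBit_mem_features (i := 0) (b := r.read) (c := c) (by simp; omega)
        (by simp only [symbols, List.mem_append, List.mem_map]; exact .inl ⟨r, hr, rfl⟩)))
    convert h1.and h2 using 3 with x
    · simp [stateBit, Bool.beq_comm]
    · simp [cellBit, BEq.comm]
  · rcases mem_features hg with ⟨r, hr, rfl⟩ | ⟨i, b, hb, hi, rfl⟩
    · exact .base (mem_featureSet (stateBit_mem_features hr _))
    · exact .base (mem_featureSet (cellBit_mem_features (by push_cast; omega) hb))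
  · rcases mem_features hg with ⟨r', hr', rfl⟩ | ⟨i, b', hb', hi, rfl⟩
    -- Once rule and coin are fixed, the new state is a constant; the tape here is a dummy.
    · exact .const (stateBit r'.state ⟨(if b then r.act₁ else r.act₀).next, default⟩)
    · rcases nth_fire r b i with ⟨w, hw⟩ | ⟨j, hj, hw⟩
      · simp only [cellBit, hw]
        exact .const _
      · simp only [cellBit, hw]
        exact .base (mem_featureSet (cellBit_mem_features (i := j) (by push_cast; omega) hb'))

variable {n : ℕ}

/-- A circuit for the configuration after a run. -/
theorem hasCircuit_run (c : PTM) (W B : ℕ) (cs : List Bool) (hB : W + cs.length ≤ B) (s : ℕ)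
    (S : Set ((Fin n → Bool) → Bool)) (cfg : (Fin n → Bool) → Cfg) (h : HasCircuit n s S)
    (hS : c.featureSet (W + cs.length) cfg ⊆ S) :
    HasCircuit n (s + cs.length * ((c.features B).length * (c.rules.length * 13 + 1)))
      (S ∪ c.featureSet W fun x => cs.foldl c.step (cfg x)) := by
  induction cs generalizing s S cfg with
  | nil => simpa using h.subset (by simpa using hS)
  | cons b cs ih =>
    simp only [List.length_cons] at hB hS
    -- One layer of the circuit per step: every feature in the window that is still needed gets a
    -- formula in the features of the next larger window.
    have h1 := h.union_formulas ((c.features (W + cs.length)).map fun g x => g (c.step (cfg x) b))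
      (fun f hf => (formula_step cfg b hf).subset hS)
    have h2 := ih (by omega) _ _ (fun x => c.step (cfg x) b) h1 Set.subset_union_right
    refine (h2.mono ?_).subset ?_
    · have : (c.features (W + cs.length)).length ≤ (c.features B).length := by
        rw [length_features, length_features]
        gcongr
        omega
      have := Nat.mul_le_mul this (le_refl (c.rules.length * 13 + 1))
      simp only [List.length_map, List.length_cons, add_mul, one_mul] at *
      omega
    · intro x hx
      simp only [Set.mem_union, List.foldl_cons] at hx ⊢
      tauto

theorem nth_mk₁ (l : List ℕ) (i : ℤ) :
    (Turing.Tape.mk₁ l).nth i = if i < 0 then 0 else l.getI i.toNat := by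
  obtain ⟨k, rfl | rfl⟩ := i.eq_nat_or_neg
  · simp [Turing.Tape.mk₁, Turing.Tape.mk₂, Turing.ListBlank.nth_mk]
  · cases k with
    | zero => simp [Turing.Tape.mk₁, Turing.Tape.mk₂, Turing.Tape.mk']
              cases l <;> simp [List.headI, List.getI]
    | succ k =>
      rw [if_pos (by omega)]
      change (Turing.ListBlank.mk ([] : List ℕ)).nth k = 0
      rw [Turing.ListBlank.nth_mk]
      simp

theorem getI_map_symbol (l : List (Option Bool)) (i : ℕ) :
    (l.map symbol).getI i = (l[i]?.map symbol).getD 0 := by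
  rw [List.getI_eq_getElem?_getD, List.getElem?_map]
  rfl

/-- A circuit for the initial configuration. -/
theorem formula_init (c : PTM) (W : ℕ) (inp : (Fin n → Bool) → List (Option Bool))
    (hinp : ∀ j : ℕ, (∃ o, ∀ x, (inp x)[j]? = o) ∨ ∃ i, ∀ x, (inp x)[j]? = some (some (x i)))
    {f : (Fin n → Bool) → Bool} (hf : f ∈ c.featureSet W fun x => init (inp x)) :
    Formula (HasCircuit.inputs n) 1 f := by
  simp only [featureSet, Set.mem_ofPred_eq, List.mem_map] at hf
  obtain ⟨g, hg, rfl⟩ := hf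
  rcases mem_features hg with ⟨r, hr, rfl⟩ | ⟨i, b, hb, hi, rfl⟩
  · exact .const (stateBit r.state ⟨0, default⟩)
  · simp only [cellBit, init, nth_mk₁, getI_map_symbol]
    by_cases hi0 : i < 0
    · simp only [hi0, if_true]
      exact .const _
    · simp only [hi0, if_false]
      rcases hinp i.toNat with ⟨o, ho⟩ | ⟨k, hk⟩
      · simp only [ho]
        exact .const _
      · simp only [hk, Option.map_some, Option.getD_some]
        have h1 : Formula (HasCircuit.inputs n) 0 (fun x => x k) := .base ⟨k, rfl⟩
        -- The symbol 2 encodes `true` and 1 encodes `false`, so the feature is the input bit, its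
        -- negation, or constantly `false`.
        by_cases h2 : b = 2
        · convert h1.mono (Nat.zero_le 1) using 2 with x
          cases x k <;> simp [symbol, h2]
        · by_cases h3 : b = 1
          · convert h1.not using 2 with x
            cases x k <;> simp [symbol, h3]
          · convert Formula.const false using 2 with x
            cases x k <;> simp [symbol, Ne.symm h2, Ne.symm h3]

end PTM

/-! Binary numbers -/

theorem binValue_nil : binValue [] = 0 := rfl

theorem binValue_cons (b : Bool) (l : List Bool) : binValue (b :: l) = b.toNat + 2 * binValue l := by
  simp [binValue, Nat.ofDigits_cons]

theorem two_pow_le_binValue (l : List Bool) (i : ℕ) (h : l[i]? = some true) :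
    2 ^ i ≤ binValue l := by
  induction l generalizing i with
  | nil => simp at h
  | cons b l ih =>
    rw [binValue_cons]
    cases i with
    | zero => simp at h; simp [h]
    | succ i =>
      have := ih i (by simpa using h)
      rw [pow_succ]
      omega

theorem binValue_lt (l : List Bool) (m : ℕ) (h : ∀ i, m ≤ i → l[i]? ≠ some true) :
    binValue l < 2 ^ m := by
  induction l generalizing m with
  | nil => simp [binValue_nil]
  | cons b l ih =>
    rw [binValue_cons]
    cases m with
    | zero =>
      have h1 := ih 0 fun i _ => by simpa using h (i + 1) (by omega)
      have h2 := h 0 le_rfl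
      cases b <;> simp at *
      omega
    | succ m =>
      have h1 := ih m fun i hi => by simpa using h (i + 1) (by omega)
      have h2 : b.toNat ≤ 1 := by cases b <;> simp
      rw [pow_succ]
      omega

/-- Superfluous leading zeros are allowed, so the size of a number is read off the position of its
last 1 and not off the length of the string. -/
theorem exists_top_bit (l : List Bool) (h : binValue l ≠ 0) :
    ∃ i, l[i]? = some true ∧ binValue l < 2 ^ (i + 1) := by
  induction l with
  | nil => simp [binValue_nil] at h
  | cons b l ih =>
    rw [binValue_cons] at h ⊢
    have h2 : b.toNat ≤ 1 := by cases b <;> simp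
    by_cases hl : binValue l = 0
    · refine ⟨0, ?_, by simp; omega⟩
      cases b <;> simp_all
    · obtain ⟨i, hi, h1⟩ := ih hl
      refine ⟨i + 1, by simpa using hi, ?_⟩
      rw [pow_succ]
      omega

namespace PTM

/-! The length of the output of a probabilistic machine -/

/-- The head moves by at most one cell per step, so the nonblank region, seen from the head, grows
by at most one. -/
theorem nth_foldl_step (c : PTM) (cs : List Bool) (B : ℕ) (s : Cfg)
    (h : ∀ i : ℤ, (B : ℤ) < |i| → s.tape.nth i = 0) (i : ℤ) (hi : (B : ℤ) + cs.length < |i|) :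
    (cs.foldl c.step s).tape.nth i = 0 := by
  induction cs generalizing s B with
  | nil => exact h i (by simpa using hi)
  | cons b cs ih =>
    refine ih (B + 1) (c.step s b) (fun i hi => ?_) (by simp at hi; push_cast; omega)
    push_cast at hi
    rw [step_eq]
    cases hr : c.ruleAt s with
    | none => exact h i (by omega)
    | some r =>
      simp only [fire]
      generalize (if b then r.act₁ else r.act₀) = a
      obtain ⟨n, w, d⟩ := a
      have h3 : ∀ j : ℤ, (B : ℤ) < |j| → (s.tape.write w).nth j = 0 := by
        intro j hj
        have : j ≠ 0 := by rintro rfl; simp at hj; omega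
        simp [this, h j hj]
      cases d with
      | left =>
        simp only [Turing.Tape.move_left_nth]
        refine h3 _ ?_
        have := abs_sub_abs_le_abs_sub i 1
        simp at this
        omega
      | right =>
        simp only [Turing.Tape.move_right_nth]
        refine h3 _ ?_
        have := abs_sub_abs_le_abs_sub i (-1)
        simp at this
        omega

theorem nth_init (inp : List (Option Bool)) (i : ℤ) (h : (inp.length : ℤ) < |i|) :
    (init inp).tape.nth i = 0 := by
  rw [init, nth_mk₁, getI_map_symbol]
  split_ifs with hi
  · rfl
  · rw [List.getElem?_eq_none (by rw [abs_of_nonneg (by omega)] at h; omega)]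
    rfl

theorem symbol_ne_zero (o : Option Bool) : symbol o ≠ 0 := by
  rcases o with _ | _ | _ <;> simp [symbol]

theorem nth_of_right₀ {t : Turing.Tape ℕ} {out : List (Option Bool)}
    (h : t.right₀ = Turing.ListBlank.mk (out.map symbol)) (i : ℕ) :
    t.nth i = (out[i]?.map symbol).getD 0 := by
  rw [← Turing.Tape.right₀_nth, h, Turing.ListBlank.nth_mk, getI_map_symbol]

/-- Output symbols are never blank, so the output cannot reach into the region that is still blank.
-/
theorem length_output_le (c : PTM) (cs : List Bool) (inp out : List (Option Bool))
    (h : (cs.foldl c.step (init inp)).tape.right₀ = Turing.ListBlank.mk (out.map symbol)) :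
    out.length ≤ inp.length + cs.length + 1 := by
  by_contra! hlt
  have h1 := nth_of_right₀ h (inp.length + cs.length + 1)
  rw [nth_foldl_step c cs inp.length _ (nth_init inp) _ (by
    rw [abs_of_nonneg (by positivity)]; push_cast; omega), List.getElem?_eq_getElem hlt] at h1
  exact symbol_ne_zero _ h1.symm

/-! A combinatorial estimate of the output -/

/-- If the tape from the head to the right reads `u#v`, where `#` is in the first `W` cells, this
says that the binary number `v` is at most `j` digits longer than `u`. -/
def decode (W j : ℕ) (s : Cfg) : Bool :=
  (List.range W).any fun p => (List.range W).any fun i =>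
    (decide (i < p) && (cellBit p 3 s && cellBit i 2 s)) &&
      (List.range W).all fun k => decide (k ≤ p + 1 + i + j) || !cellBit k 2 s

theorem cellBit_eq_true {s : Cfg} {out : List (Option Bool)}
    (h : s.tape.right₀ = Turing.ListBlank.mk (out.map symbol)) (i : ℕ) (o : Option Bool) :
    cellBit i (symbol o) s = true ↔ out[i]? = some o := by
  rw [cellBit, nth_of_right₀ h, beq_iff_eq]
  rcases hx : out[i]? with _ | x
  · simp [(symbol_ne_zero o).symm]
  · rcases x with _ | _ | _ <;> rcases o with _ | _ | _ <;> simp [symbol]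

/-- The separator occurs only once, so `p` has to be `u.length`, and digit `k` of `v` is in cell
`u.length + 1 + k`. As the window covers the whole output, no digit is missed. -/
theorem decode_iff {W j : ℕ} {s : Cfg} {u v : List Bool}
    (h : s.tape.right₀ = Turing.ListBlank.mk ((pairEnc u v).map symbol))
    (hW : (pairEnc u v).length ≤ W) :
    decode W j s = true ↔ ∃ i, u[i]? = some true ∧ ∀ k, i + j < k → v[k]? ≠ some true := by
  have h3 : ∀ p : ℕ, cellBit p 3 s = true ↔ p = u.length := by
    intro p
    rw [show 3 = symbol none from rfl, cellBit_eq_true h, pairEnc]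
    constructor
    · intro hp
      rcases lt_trichotomy p u.length with hl | rfl | hl
      · rw [List.getElem?_append_left (by simpa using hl)] at hp
        simp at hp
      · rfl
      · rw [List.getElem?_append_right (by simp; omega)] at hp
        obtain ⟨k, hk⟩ : ∃ k, p = u.length + k + 1 := ⟨p - u.length - 1, by omega⟩
        subst hk
        rw [show u.length + k + 1 - (u.map some).length = k + 1 by simp; omega] at hp
        simp at hp
    · rintro rfl
      simp
  have h2 : ∀ i < u.length, (cellBit i 2 s = true ↔ u[i]? = some true) := by
    intro i hi
    rw [show 2 = symbol (some true) from rfl, cellBit_eq_true h, pairEnc,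
      List.getElem?_append_left (by simpa using hi)]
    simp
  have h2' : ∀ k : ℕ, (cellBit ((u.length + 1 + k : ℕ) : ℤ) 2 s = true ↔ v[k]? = some true) := by
    intro k
    rw [show 2 = symbol (some true) from rfl, cellBit_eq_true h, pairEnc,
      List.getElem?_append_right (by simp; omega)]
    rw [show u.length + 1 + k - (u.map some).length = k + 1 by simp; omega]
    simp
  have hl : u.length + 1 + v.length ≤ W := by
    simp [pairEnc] at hW
    omega
  simp only [decode, List.any_eq_true, List.mem_range, Bool.and_eq_true, decide_eq_true_eq,
    List.all_eq_true, Bool.or_eq_true, Bool.not_eq_true', h3]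
  constructor
  · rintro ⟨p, hp, i, hi, ⟨hip, rfl, hc⟩, hall⟩
    refine ⟨i, (h2 i hip).1 hc, fun k hk hv => ?_⟩
    have hkv : k < v.length := (List.getElem?_eq_some_iff.1 hv).1
    rcases hall (u.length + 1 + k) (by omega) with h5 | h5
    · omega
    · rw [(h2' k).2 hv] at h5
      simp at h5
  · rintro ⟨i, hi, hv⟩
    have hiu : i < u.length := (List.getElem?_eq_some_iff.1 hi).1
    refine ⟨u.length, by omega, i, by omega, ⟨hiu, rfl, (h2 i hiu).2 hi⟩, fun k hk => ?_⟩
    by_cases hle : k ≤ u.length + 1 + i + j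
    · exact .inl hle
    · right
      obtain ⟨k, rfl⟩ : ∃ k', k = u.length + 1 + k' := ⟨k - (u.length + 1), by omega⟩
      have := hv k (by omega)
      rw [Ne, ← h2' k] at this
      simpa using this

/-- If `i` is the top digit of `u`, then `v ≤ u * 2 ^ j < 2 ^ (i + 1 + j)`, which excludes a digit 1
of `v` beyond `i + j`. -/
theorem decode_of_one_le {W j : ℕ} {s : Cfg} {out : List (Option Bool)} {r : ℚ}
    (h : s.tape.right₀ = Turing.ListBlank.mk (out.map symbol)) (hr : RepresentsRat out r)
    (hW : out.length ≤ W) (h1 : 1 ≤ r * 2 ^ j) : decode W j s = true := by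
  obtain ⟨u, v, rfl, hv, rfl⟩ := hr
  rw [decode_iff h hW]
  have hv' : (0 : ℚ) < binValue v := by positivity
  have h2 : binValue v ≤ binValue u * 2 ^ j := by
    rw [div_mul_eq_mul_div, le_div_iff₀ hv', one_mul] at h1
    exact_mod_cast h1
  have hu : binValue u ≠ 0 := by
    intro hu
    simp [hu] at h2
    exact hv h2
  obtain ⟨i, hi, h3⟩ := exists_top_bit u hu
  refine ⟨i, hi, fun k hk hvk => ?_⟩
  have h4 := two_pow_le_binValue v k hvk
  have h5 : 2 ^ (i + 1 + j) ≤ 2 ^ k := Nat.pow_le_pow_right (by norm_num) (by omega)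
  have h6 : binValue u * 2 ^ j < 2 ^ (i + 1) * 2 ^ j :=
    Nat.mul_lt_mul_of_pos_right h3 (by positivity)
  rw [← pow_add] at h6
  omega

/-- Here `v < 2 ^ (i + j + 1) ≤ u * 2 ^ (j + 1)`. Comparing only leading digits loses a factor of 2
against `decode_of_one_le`; the gap between the two cases of the reduction leaves room for it. -/
theorem one_lt_of_decode {W j : ℕ} {s : Cfg} {out : List (Option Bool)} {r : ℚ}
    (h : s.tape.right₀ = Turing.ListBlank.mk (out.map symbol)) (hr : RepresentsRat out r)
    (hW : out.length ≤ W) (hd : decode W j s = true) : 1 < r * 2 ^ (j + 1) := by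
  obtain ⟨u, v, rfl, hv, rfl⟩ := hr
  rw [decode_iff h hW] at hd
  obtain ⟨i, hi, hk⟩ := hd
  have hv' : (0 : ℚ) < binValue v := by positivity
  have h1 := two_pow_le_binValue u i hi
  have h2 := binValue_lt v (i + j + 1) fun k hk' => hk k (by omega)
  rw [div_mul_eq_mul_div, lt_div_iff₀ hv', one_mul]
  have h3 : 2 ^ i * 2 ^ (j + 1) ≤ binValue u * 2 ^ (j + 1) := Nat.mul_le_mul_right _ h1
  rw [← pow_add, ← add_assoc] at h3
  exact_mod_cast h2.trans_le h3

variable {X : Type}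

/-- Three nested ranges of length `W` over cell bits; the comparisons of positions are constants of
the formula. -/
theorem formula_decode (c : PTM) (W j : ℕ) (cfg : X → Cfg) :
    Formula (c.featureSet W cfg) (W * (W * (9 * W + 12) + 4) + 1)
      fun x => decode W j (cfg x) := by
  have hc : ∀ i < W, ∀ b ∈ [2, 3], Formula (c.featureSet W cfg) 0
      fun x => cellBit (i : ℤ) b (cfg x) := by
    intro i hi b hb
    refine .base (mem_featureSet (cellBit_mem_features ?_ ?_))
    · rw [abs_of_nonneg (by positivity)]
      exact_mod_cast hi.le
    · simp only [symbols, List.mem_append]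
      right
      fin_cases hb <;> simp
  have h1 : ∀ p < W, ∀ i < W, Formula (c.featureSet W cfg) (9 * W + 9) fun x =>
      (decide (i < p) && (cellBit p 3 (cfg x) && cellBit i 2 (cfg x))) &&
        (List.range W).all fun k => decide (k ≤ p + 1 + i + j) || !cellBit k 2 (cfg x) := by
    intro p hp i hi
    have h2 := Formula.all (List.range W)
      (fun k x => decide (k ≤ p + 1 + i + j) || !cellBit k 2 (cfg x)) (fun k hk =>
        (Formula.const (decide (k ≤ p + 1 + i + j))).or
          (hc k (List.mem_range.1 hk) 2 (by simp)).not)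
    exact ((((Formula.const (decide (i < p))).and
      ((hc p hp 3 (by simp)).and (hc i hi 2 (by simp)))).and h2).mono (by simp; omega))
  have h2 : ∀ p < W, Formula (c.featureSet W cfg) (W * (9 * W + 12) + 1) fun x =>
      (List.range W).any fun i =>
        (decide (i < p) && (cellBit p 3 (cfg x) && cellBit i 2 (cfg x))) &&
          (List.range W).all fun k => decide (k ≤ p + 1 + i + j) || !cellBit k 2 (cfg x) := by
    intro p hp
    exact (Formula.any (List.range W) _ fun i hi => h1 p hp i (List.mem_range.1 hi)).mono
      (by simp)
  exact (Formula.any (List.range W) _ fun p hp => h2 p (List.mem_range.1 hp)).mono (by simp)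

end PTM

/-! Fixing the coins of many independent runs for all inputs at once -/

open Finset in
/-- A large majority of good values of `c` makes tuples without a good majority rare. -/
theorem card_minority_le {C : Type} [Fintype C] [DecidableEq C] (good : C → Bool)
    (h : 2 * Fintype.card C < 3 * #{c | good c = true}) (R : ℕ) :
    #{cs : Fin R → C | 2 * #{i | good (cs i) = true} ≤ R} * 18 ^ R ≤
      17 ^ R * Fintype.card C ^ R := by
  -- An exponential moment bound in integers. Since `4 * 9 = 6 ^ 2`, a tuple without a good majority
  -- has `φ`-product at least `6 ^ R`, while the mean of `φ` is at most `4 * (2/3) + 9 * (1/3) =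
  -- 17/3`. By Markov's inequality the fraction of such tuples is at most `(17/18) ^ R`.
  set φ : C → ℕ := fun c => bif good c then 4 else 9 with hφ
  have hsum : 3 * ∑ c, φ c ≤ 17 * Fintype.card C := by
    have h1 : ∑ c, φ c = 4 * #{c | good c = true} + 9 * #{c | ¬ good c = true} := by
      rw [← sum_filter_add_sum_filter_not univ (fun c => good c = true),
        sum_congr rfl (g := fun _ => 4), sum_const, sum_congr rfl (g := fun _ => 9), sum_const]
      · simp [mul_comm]
      · intro c hc
        simp at hc
        simp [hφ, hc]
      · intro c hc
        simp at hc
        simp [hφ, hc]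
    have h2 := card_filter_add_card_filter_not (s := (univ : Finset C)) (fun c => good c = true)
    rw [card_univ] at h2
    omega
  have hprod : ∀ cs : Fin R → C, 2 * #{i | good (cs i) = true} ≤ R → 6 ^ R ≤ ∏ i, φ (cs i) := by
    intro cs hcs
    have h1 : ∏ i, φ (cs i) = 4 ^ #{i | good (cs i) = true} * 9 ^ #{i | ¬ good (cs i) = true} := by
      rw [← prod_filter_mul_prod_filter_not univ (fun i => good (cs i) = true),
        prod_congr rfl (g := fun _ => 4), prod_const, prod_congr rfl (g := fun _ => 9), prod_const]
      · intro c hc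
        simp at hc
        simp [hφ, hc]
      · intro c hc
        simp at hc
        simp [hφ, hc]
    have h2 := card_filter_add_card_filter_not (s := (univ : Finset (Fin R)))
      (fun i => good (cs i) = true)
    rw [card_univ, Fintype.card_fin] at h2
    rw [h1]
    generalize #{i | good (cs i) = true} = g at *
    generalize #{i | ¬ good (cs i) = true} = b at *
    obtain ⟨d, rfl⟩ : ∃ d, b = g + d := ⟨b - g, by omega⟩
    calc 6 ^ R = (6 * 6) ^ g * 6 ^ d := by
          rw [← h2, mul_pow, ← pow_add, ← pow_add, add_assoc]
      _ ≤ (4 * 9) ^ g * 9 ^ d :=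
          Nat.mul_le_mul le_rfl (Nat.pow_le_pow_left (by norm_num) d)
      _ = _ := by rw [mul_pow, pow_add, mul_assoc]
  have h3 : #{cs : Fin R → C | 2 * #{i | good (cs i) = true} ≤ R} * 6 ^ R ≤ (∑ c, φ c) ^ R := by
    rw [Fintype.sum_pow]
    calc _ = ∑ cs : Fin R → C with 2 * #{i | good (cs i) = true} ≤ R, 6 ^ R := by
          rw [sum_const, smul_eq_mul]
      _ ≤ ∑ cs : Fin R → C with 2 * #{i | good (cs i) = true} ≤ R, ∏ i, φ (cs i) :=
          sum_le_sum fun cs hcs => hprod cs (mem_filter.1 hcs).2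
      _ ≤ _ := sum_le_sum_of_subset (filter_subset _ _)
  calc _ = #{cs : Fin R → C | 2 * #{i | good (cs i) = true} ≤ R} * 6 ^ R * 3 ^ R := by
        rw [show 18 = 6 * 3 from rfl, mul_pow, mul_assoc]
    _ ≤ (∑ c, φ c) ^ R * 3 ^ R := Nat.mul_le_mul_right _ h3
    _ = (3 * ∑ c, φ c) ^ R := by rw [mul_pow, mul_comm]
    _ ≤ (17 * Fintype.card C) ^ R := Nat.pow_le_pow_left hsum R
    _ = _ := mul_pow _ _ _

open Finset in
/-- If a random `c` is good for each `x` with probability greater than `2/3`, then for some choice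
of sufficiently many `c`s, more than half of them are good for every `x`. -/
theorem exists_majority {X C : Type} [Fintype X] [Nonempty X] [Fintype C] (good : X → C → Bool)
    (h : ∀ x, 2 * Fintype.card C < 3 * #{c | good x c = true}) (R : ℕ)
    (hR : Fintype.card X * 17 ^ R < 18 ^ R) :
    ∃ cs : Fin R → C, ∀ x, R < 2 * #{i | good x (cs i) = true} := by
  classical
  by_contra! hcon
  have hC : 0 < Fintype.card C := by
    obtain ⟨x⟩ := ‹Nonempty X›
    by_contra h0
    have h1 := h x
    have h2 := card_filter_le (univ : Finset C) fun c => good x c = true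
    rw [card_univ] at h2
    omega
  -- Union bound: if every tuple failed for some `x`, the sets of failures would cover all tuples.
  have h1 : Fintype.card C ^ R ≤
      ∑ x : X, #{cs : Fin R → C | 2 * #{i | good x (cs i) = true} ≤ R} := by
    calc Fintype.card C ^ R = #(univ : Finset (Fin R → C)) := by simp
      _ ≤ #(univ.biUnion fun x : X =>
          ({cs : Fin R → C | 2 * #{i | good x (cs i) = true} ≤ R} : Finset _)) := by
        refine card_le_card fun cs _ => ?_
        obtain ⟨x, hx⟩ := hcon cs
        simp only [mem_biUnion, mem_univ, true_and, mem_filter]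
        exact ⟨x, hx⟩
      _ ≤ _ := card_biUnion_le
  have h2 := Nat.mul_le_mul_right (18 ^ R) h1
  rw [sum_mul] at h2
  have h3 := h2.trans (sum_le_sum fun x _ => card_minority_le (good x) (h x) R)
  rw [sum_const, card_univ, smul_eq_mul, ← mul_assoc, mul_comm] at h3
  exact absurd (Nat.le_of_mul_le_mul_right h3 (by positivity)) (by omega)

/-! Majority circuits -/

/-- Dynamic programming over the list: the count with `b` added reaches `j + 1` iff `b` holds and
the old count reaches `j`, or the old count reaches `j + 1`. This costs 5 gates per threshold and
list element. -/
theorem HasCircuit.threshold {n s : ℕ} {S : Set ((Fin n → Bool) → Bool)} (J : ℕ)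
    (bs : List ((Fin n → Bool) → Bool)) (h : HasCircuit n s S) (hbs : ∀ b ∈ bs, b ∈ S) :
    HasCircuit n (s + (J + 1) * (5 * (bs.length + 1)))
      (S ∪ {f | ∃ j ≤ J, f = fun x => decide (j ≤ bs.countP fun b => b x)}) := by
  induction bs with
  | nil =>
    have h1 := h.union_formulas ((List.range (J + 1)).map fun j x => decide (j = 0)) (k := 1) (by
      intro f hf
      obtain ⟨j, -, rfl⟩ := List.mem_map.1 hf
      exact .const _)
    refine (h1.mono (by simp)).subset (Set.union_subset_union_right _ ?_)
    rintro f ⟨j, hj, rfl⟩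
    simp only [Set.mem_ofPred_eq, List.mem_map, List.mem_range]
    exact ⟨j, by omega, by simp⟩
  | cons b bs ih =>
    have h0 := ih fun b hb => hbs b (by simp [hb])
    have h1 := h0.union_formulas
      ((List.range (J + 1)).map fun j x => decide (j ≤ (b :: bs).countP fun b => b x)) (k := 5) (by
        intro f hf
        obtain ⟨j, hj, rfl⟩ := List.mem_map.1 hf
        rw [List.mem_range] at hj
        cases j with
        | zero => simpa using Formula.true
        | succ j =>
          have hb : Formula (S ∪ {f | ∃ j ≤ J, f = fun x => decide (j ≤ bs.countP fun b => b x)})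
            0 b := .base (.inl (hbs b (by simp)))
          have h2 : Formula (S ∪ {f | ∃ j ≤ J, f = fun x => decide (j ≤ bs.countP fun b => b x)})
            0 (fun x => decide (j ≤ bs.countP fun b => b x)) := .base (.inr ⟨j, by omega, rfl⟩)
          have h3 : Formula (S ∪ {f | ∃ j ≤ J, f = fun x => decide (j ≤ bs.countP fun b => b x)})
            0 (fun x => decide (j + 1 ≤ bs.countP fun b => b x)) :=
            .base (.inr ⟨j + 1, by omega, rfl⟩)
          convert (hb.and h2).or h3 using 2 with x
          rw [List.countP_cons, Bool.eq_iff_iff]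
          cases b x <;> simp
          omega)
    refine (h1.mono ?_).subset ?_
    · simp
      ring_nf
      omega
    · rintro f (hf | ⟨j, hj, rfl⟩)
      · exact .inl (.inl hf)
      · right
        simp only [Set.mem_ofPred_eq, List.mem_map, List.mem_range]
        exact ⟨j, by omega, rfl⟩

/-! Polynomially bounded functions -/

/-- `f` is bounded by a polynomial. -/
def PolyBounded (f : ℕ → ℕ) : Prop := ∃ p : Polynomial ℕ, ∀ n, f n ≤ p.eval n

namespace PolyBounded

variable {f g : ℕ → ℕ}

theorem eval (p : Polynomial ℕ) : PolyBounded fun n => p.eval n := ⟨p, fun _ => le_rfl⟩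

theorem const (c : ℕ) : PolyBounded fun _ => c := ⟨Polynomial.C c, by simp⟩

theorem id : PolyBounded fun n => n := ⟨Polynomial.X, by simp⟩

theorem add (hf : PolyBounded f) (hg : PolyBounded g) : PolyBounded fun n => f n + g n := by
  obtain ⟨p, hp⟩ := hf
  obtain ⟨q, hq⟩ := hg
  exact ⟨p + q, fun n => by simpa using Nat.add_le_add (hp n) (hq n)⟩

theorem mul (hf : PolyBounded f) (hg : PolyBounded g) : PolyBounded fun n => f n * g n := by
  obtain ⟨p, hp⟩ := hf
  obtain ⟨q, hq⟩ := hg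
  exact ⟨p * q, fun n => by simpa using Nat.mul_le_mul (hp n) (hq n)⟩

theorem mono (hf : PolyBounded f) (h : ∀ n, g n ≤ f n) : PolyBounded g := by
  obtain ⟨p, hp⟩ := hf
  exact ⟨p, fun n => (h n).trans (hp n)⟩

theorem comp (hf : PolyBounded f) (p : Polynomial ℕ) : PolyBounded fun n => f (p.eval n) := by
  obtain ⟨q, hq⟩ := hf
  exact ⟨q.comp p, fun n => by simpa using hq (p.eval n)⟩

end PolyBounded

/-! A circuit for the majority vote of many runs of a probabilistic machine -/

namespace PTM

variable {n : ℕ}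

/-- The size of a circuit for the majority of `R` runs of `T` steps, for a machine with `r` rules,
with an output of length at most `W`. -/
def voteSize (r T W R : ℕ) : ℕ :=
  (r + (2 * (W + T) + 1) * (r + 4)) +
    R * (T * ((r + (2 * (W + T) + 1) * (r + 4)) * (r * 13 + 1)) +
      (W * (W * (9 * W + 12) + 4) + 1)) +
    (R + 2) * (5 * (R + 1))

/-- All runs start from the same wires for the initial configuration, and of each run only the
decoded verdict is kept. -/
theorem hasCircuit_runs (c : PTM) (T W j : ℕ) (S : Set ((Fin n → Bool) → Bool)) (s : ℕ)
    (cfg : (Fin n → Bool) → Cfg) (h : HasCircuit n s S) (hS : c.featureSet (W + T) cfg ⊆ S)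
    (cs : List (List Bool)) (hcs : ∀ l ∈ cs, l.length = T) :
    HasCircuit n (s + cs.length * (T * ((c.features (W + T)).length * (c.rules.length * 13 + 1)) +
      (W * (W * (9 * W + 12) + 4) + 1)))
      (S ∪ {f | f ∈ cs.map fun (l : List Bool) x => decode W j (l.foldl c.step (cfg x))}) := by
  induction cs with
  | nil => simpa using h
  | cons l cs ih =>
    have hl : l.length = T := hcs l (by simp)
    have h1 := c.hasCircuit_run W (W + T) l (by omega) _ _ cfg
      (ih fun l hl => hcs l (by simp [hl])) (by rw [hl]; exact hS.trans Set.subset_union_left)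
    have h2 := h1.insert_formula
      ((formula_decode c W j fun x => l.foldl c.step (cfg x)).subset Set.subset_union_right)
    refine (h2.mono ?_).subset ?_
    · rw [hl, List.length_cons, add_mul, one_mul]
      omega
    · intro f hf
      simp only [List.map_cons, List.mem_cons, Set.mem_union, Set.mem_ofPred_eq,
        Set.mem_insert_iff] at hf ⊢
      tauto

theorem hasCircuit_vote (c : PTM) (T W j R : ℕ) (inp : (Fin n → Bool) → List (Option Bool))
    (hinp : ∀ j : ℕ, (∃ o, ∀ x, (inp x)[j]? = o) ∨ ∃ i, ∀ x, (inp x)[j]? = some (some (x i)))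
    (cs : Fin R → Fin T → Bool) :
    HasCircuit n (voteSize c.rules.length T W R)
      {fun x => decide (R < 2 * (Finset.univ.filter fun i =>
        decode W j (c.run (inp x) (cs i)) = true).card)} := by
  have h0 := (HasCircuit.of_inputs n).union_formulas
    ((c.features (W + T)).map fun g x => g (init (inp x)))
    (fun f hf => formula_init c (W + T) inp hinp hf)
  have h1 := hasCircuit_runs c T W j _ _ (fun x => init (inp x)) h0 Set.subset_union_right
    ((List.finRange R).map fun i => List.ofFn (cs i)) (by simp)
  have h2 := h1.threshold (R / 2 + 1)
    (((List.finRange R).map fun i => List.ofFn (cs i)).map fun (l : List Bool) x =>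
      decode W j (l.foldl c.step (init (inp x)))) (fun b hb => .inr hb)
  refine (h2.mono ?_).subset ?_
  · simp only [voteSize, List.length_map, List.length_finRange, length_features]
    have : (R / 2 + 1 + 1) * (5 * (R + 1)) ≤ (R + 2) * (5 * (R + 1)) := by
      exact Nat.mul_le_mul (by omega) le_rfl
    omega
  · rintro f hf
    rw [Set.mem_singleton_iff] at hf
    subst hf
    refine .inr ⟨R / 2 + 1, le_rfl, ?_⟩
    funext x
    rw [decide_eq_decide]
    have : (Finset.univ.filter fun i => decode W j (c.run (inp x) (cs i)) = true).card =
        (((List.finRange R).map fun i => List.ofFn (cs i)).map fun (l : List Bool) x =>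
          decode W j (l.foldl c.step (init (inp x)))).countP fun b => b x := by
      rw [Finset.card_def, Finset.filter_val, ← Multiset.countP_eq_card_filter, Fin.univ_def,
        Multiset.coe_countP]
      rw [List.countP_map, List.countP_map]
      refine List.countP_congr fun i _ => ?_
      simp only [run, Function.comp_apply]
      exact decide_eq_true_iff
    rw [this]
    omega

theorem length_rules_le (c : PTM) : c.rules.length ≤ c.encode.length := by
  obtain ⟨l⟩ := c
  simp only [encode]
  induction l with
  | nil => simp
  | cons r l ih =>
    have := List.length_pos_iff.2 (encodeRule_ne_nil r)
    simp only [List.flatMap_cons, List.length_append, List.length_cons]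
    omega

end PTM

theorem PolyBounded.voteSize {r T W R : ℕ → ℕ} (hr : PolyBounded r) (hT : PolyBounded T)
    (hW : PolyBounded W) (hR : PolyBounded R) :
    PolyBounded fun n => PTM.voteSize (r n) (T n) (W n) (R n) := by
  have hk : ∀ k, PolyBounded fun _ => k := PolyBounded.const
  have hl := hr.add ((((hk 2).mul (hW.add hT)).add (hk 1)).mul (hr.add (hk 4)))
  exact (hl.add (hR.mul ((hT.mul (hl.mul ((hr.mul (hk 13)).add (hk 1)))).add
    ((hW.mul ((hW.mul (((hk 9).mul hW).add (hk 12))).add (hk 4))).add (hk 1))))).add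
    ((hR.add (hk 2)).mul ((hk 5).mul (hR.add (hk 1))))

/-! From approximate local probabilities to circuits -/

/-- The string `u`, followed by `x`, with every bit preceded by `0`, and by a final `1`. -/
def query (u x : List Bool) : List Bool := u ++ (x.flatMap (fun b => [false, b]) ++ [true])

theorem length_query (u x : List Bool) : (query u x).length = u.length + 2 * x.length + 1 := by
  simp [query, List.length_flatMap, mul_comm]
  omega

/-- For fixed `u`, a query depends on `x` bit by bit at fixed positions, so a circuit needs no gates
to form it. The final `some false` is the symbol whose probability is asked for. -/
theorem getElem?_query {n : ℕ} (u : List Bool) (l : List (Fin n)) (j : ℕ) :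
    (∃ o, ∀ x : Fin n → Bool, ((query u (l.map x)).map some ++ [some false])[j]? = o) ∨
      ∃ i, ∀ x : Fin n → Bool,
        ((query u (l.map x)).map some ++ [some false])[j]? = some (some (x i)) := by
  induction u generalizing j with
  | cons b u ih =>
    cases j with
    | zero => exact .inl ⟨some (some b), fun x => by simp [query]⟩
    | succ j => simpa [query] using ih j
  | nil =>
    induction l generalizing j with
    | nil => exact .inl ⟨[some true, some false][j]?, fun x => by simp [query]⟩
    | cons k l ih =>
      match j with
      | 0 => exact .inl ⟨some (some false), fun x => by simp [query]⟩
      | 1 => exact .inr ⟨k, fun x => by simp [query]⟩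
      | j + 2 => simpa [query] using ih j

/-- 13 is the least exponent for which `(18/17) ^ 13 ≥ 2`. -/
theorem two_pow_mul_seventeen_lt (n : ℕ) : 2 ^ n * 17 ^ (13 * (n + 1)) < 18 ^ (13 * (n + 1)) := by
  rw [pow_mul, pow_mul]
  calc 2 ^ n * (17 ^ 13) ^ (n + 1) < 2 ^ (n + 1) * (17 ^ 13) ^ (n + 1) := by
        gcongr <;> omega
    _ = (2 * 17 ^ 13) ^ (n + 1) := by rw [mul_pow]
    _ ≤ (18 ^ 13) ^ (n + 1) := Nat.pow_le_pow_left (by norm_num) _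

open Classical in
/-- If approximations of certain local probabilities are enough to tell whether `x` is in `L`, then
`L` is in P/poly. -/
theorem mem_PPoly_of_approximatelyLocallyNormalizes (L : Language Bool) {lam : ℝ}
    (hlam : 1 ≤ lam) {p : WeightedLanguage} {M : Turing.TM2ComputableAux Bool Bool}
    {θ : ℕ → List Bool} (h : ApproximatelyLocallyNormalizes lam p M θ) (j : ℕ) (hj : lam ≤ 2 ^ j)
    (u : ℕ → List Bool) (N : Polynomial ℕ)
    (hu : ∀ x : List Bool, (query (u x.length) x).length ≤ N.eval x.length)
    (hpos : ∀ x : List Bool, 0 < localProb p (query (u x.length) x) (some false))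
    (hout : ∀ x ∉ L, localProb p (query (u x.length) x) (some false) = 1)
    (hin : ∀ x ∈ L,
      localProb p (query (u x.length) x) (some false) * 2 ^ (2 * j + 1) ≤ 1) :
    L ∈ PPoly := by
  obtain ⟨q, size, build, time, hsize, hbuild, -, hprob⟩ := h
  obtain ⟨C, hC⟩ := exists_length_output_le M
  -- Inputs of length `n` lead to queries of length up to `N.eval n`, so the machine to run is `q
  -- (N.eval n)`.
  set T : ℕ → ℕ := fun n => time.eval (N.eval n) with hT
  -- The bound of `PTM.length_output_le`: the query and one more symbol, the `T n` steps, and 1.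
  set W : ℕ → ℕ := fun n => N.eval n + T n + 2 with hW
  set R : ℕ → ℕ := fun n => 13 * (n + 1) with hR
  -- Any output within the factor `lam` decodes to the right answer: `r ≥ 2⁻ʲ` if `x ∉ L`, and `r ≤
  -- 2⁻⁽ʲ⁺¹⁾` if `x ∈ L`.
  have hgood : ∀ (x : List Bool) (coins : Fin (T x.length) → Bool),
      (∃ r : ℚ, (q (N.eval x.length)).Outputs
        ((q (N.eval x.length)).run ((query (u x.length) x).map some ++ [some false]) coins) r ∧
        ApproxWithin lam r (localProb p (query (u x.length) x) (some false))) →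
      (PTM.decode (W x.length) j
        ((q (N.eval x.length)).run ((query (u x.length) x).map some ++ [some false]) coins) = true ↔
        x ∉ L) := by
    rintro x coins ⟨r, ⟨-, out, hrep, hright⟩, hr1, hr2⟩
    have hlen : out.length ≤ W x.length := by
      refine (PTM.length_output_le _ _ _ _ hright).trans ?_
      have := hu x
      simp [hW]
      omega
    have hlam0 : 0 < lam := by linarith
    constructor
    · intro hd hx
      have h1 := PTM.one_lt_of_decode hright hrep hlen hd
      have h1' : (1 : ℝ) < r * 2 ^ (j + 1) := by exact_mod_cast h1
      have h2 : (localProb p (query (u x.length) x) (some false) : ℝ) * 2 ^ (2 * j + 1) ≤ 1 := by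
        exact_mod_cast hin x hx
      rw [div_le_iff₀ hlam0] at hr1
      have h3 : (r : ℝ) * 2 ^ (j + 1) ≤
          (localProb p (query (u x.length) x) (some false) : ℝ) * 2 ^ (2 * j + 1) := by
        calc (r : ℝ) * 2 ^ (j + 1) ≤
            (localProb p (query (u x.length) x) (some false) * 2 ^ j) * 2 ^ (j + 1) := by
              gcongr
              exact hr1.trans (by gcongr)
          _ = _ := by ring
      linarith
    · intro hx
      refine PTM.decode_of_one_le hright hrep hlen ?_
      rw [hout x hx, NNReal.coe_one] at hr2
      have hr0 : (0 : ℝ) ≤ r := by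
        by_contra! h0
        nlinarith
      have : (1 : ℝ) ≤ r * 2 ^ j := by
        rw [mul_comm]
        exact hr2.trans (by gcongr)
      exact_mod_cast this
  have hvote : ∀ n, ∃ cs : Fin (R n) → Fin (T n) → Bool, ∀ x : Fin n → Bool,
      R n < 2 * (Finset.univ.filter fun i =>
        (PTM.decode (W n) j ((q (N.eval n)).run
          ((query (u n) (List.ofFn x)).map some ++ [some false]) (cs i)) ==
          decide (List.ofFn x ∉ L)) = true).card := by
    intro n
    refine exists_majority (fun (x : Fin n → Bool) coins => PTM.decode (W n) j ((q (N.eval n)).run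
          ((query (u n) (List.ofFn x)).map some ++ [some false]) coins) ==
          decide (List.ofFn x ∉ L)) (fun x => ?_) (R n) ?_
    · have h1 := hprob (N.eval n) (query (u n) (List.ofFn x)) (some false)
        (by simpa using hu (List.ofFn x)) (by simpa using hpos (List.ofFn x))
      have h2 : Nat.card {coins : Fin (T n) → Bool // ∃ r : ℚ, (q (N.eval n)).Outputs
          ((q (N.eval n)).run ((query (u n) (List.ofFn x)).map some ++ [some false]) coins) r ∧
          ApproxWithin lam r (localProb p (query (u n) (List.ofFn x)) (some false))} ≤
          (Finset.univ.filter fun coins : Fin (T n) → Bool =>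
            (PTM.decode (W n) j ((q (N.eval n)).run
              ((query (u n) (List.ofFn x)).map some ++ [some false]) coins) ==
              decide (List.ofFn x ∉ L)) = true).card := by
        rw [Nat.card_eq_fintype_card, Fintype.card_subtype]
        refine Finset.card_le_card fun coins hc => ?_
        simp only [Finset.mem_filter, Finset.mem_univ, true_and] at hc ⊢
        have h3 := hgood (List.ofFn x)
        rw [List.length_ofFn] at h3
        have h4 := h3 coins hc
        rw [beq_iff_eq, Bool.eq_iff_iff, h4, decide_eq_true_iff]
      rw [PTM.prob, lt_div_iff₀ (by positivity)] at h1
      have h5 : (2 : ℝ) * 2 ^ T n < 3 * (Nat.card {coins : Fin (T n) → Bool // ∃ r : ℚ,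
          (q (N.eval n)).Outputs
          ((q (N.eval n)).run ((query (u n) (List.ofFn x)).map some ++ [some false]) coins) r ∧
          ApproxWithin lam r (localProb p (query (u n) (List.ofFn x)) (some false))} : ℝ) := by
        have : (2 / 3 : ℝ) * 2 ^ T n < _ := h1
        linarith
      have h6 : 2 * 2 ^ T n < 3 * Nat.card {coins : Fin (T n) → Bool // ∃ r : ℚ,
          (q (N.eval n)).Outputs
          ((q (N.eval n)).run ((query (u n) (List.ofFn x)).map some ++ [some false]) coins) r ∧
          ApproxWithin lam r (localProb p (query (u n) (List.ofFn x)) (some false))} := by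
        exact_mod_cast h5
      simp only [Fintype.card_fun, Fintype.card_bool, Fintype.card_fin]
      omega
    · simpa using two_pow_mul_seventeen_lt n
  choose cs hcs using hvote
  have hsizes : PolyBounded fun n =>
      PTM.voteSize (q (N.eval n)).rules.length (T n) (W n) (R n) + 1 + 2 := by
    have hTb : PolyBounded T := (PolyBounded.eval time).comp N
    refine ((PolyBounded.voteSize ?_ hTb (((PolyBounded.eval N).add hTb).add (.const 2))
      ((PolyBounded.const 13).mul (.add .id (.const 1)))).add (.const 1)).add (.const 2)
    have h1 : PolyBounded fun n => size.eval n + C * build.eval n :=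
      (PolyBounded.eval size).add ((PolyBounded.const C).mul (.eval build))
    refine (h1.comp N).mono fun n => ?_
    -- A description written in polynomial time is of polynomial length and so lists polynomially
    -- many rules; the size of the circuit depends on the machine only through their number.
    refine (PTM.length_rules_le _).trans ((hC _ _ _ (hbuild _)).trans ?_)
    have := hsize (N.eval n)
    omega
  obtain ⟨s, hs⟩ := hsizes
  refine mem_PPoly_of_circuits L s fun n => ?_
  have h1 := PTM.hasCircuit_vote (q (N.eval n)) (T n) (W n) j (R n)
    (fun x : Fin n → Bool => (query (u n) (List.ofFn x)).map some ++ [some false])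
    (fun k => by
      simpa only [List.ofFn_eq_map] using getElem?_query (u n) (List.finRange n) k) (cs n)
  -- A large probability means `x ∉ L`, so the vote is negated.
  obtain ⟨gs, h2, h3, h4⟩ := (h1.insert_formula (Formula.not (.base rfl) (a := 0))).exists_head
    (Set.mem_insert _ _)
  refine ⟨gs, h2.trans (hs n), h3, fun x hx => ?_⟩
  subst hx
  have h5 := h4 x.get
  have h6 := hcs x.length x.get
  rw [List.ofFn_get] at h5 h6
  rw [h5]
  simp only [Bool.not_eq_true', decide_eq_false_iff_not]
  by_cases hx : x ∈ L
  · simp only [hx, iff_true]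
    simp only [hx, not_true_eq_false, decide_false, beq_iff_eq] at h6
    have h7 := Finset.card_filter_add_card_filter_not
      (s := (Finset.univ : Finset (Fin (R x.length))))
      (fun i => PTM.decode (W x.length) j ((q (N.eval x.length)).run
        ((query (u x.length) x).map some ++ [some false]) (cs x.length i)) = true)
    rw [Finset.card_univ, Fintype.card_fin] at h7
    simp only [Bool.not_eq_true] at h7
    omega
  · simp only [hx, iff_false, not_not]
    simpa [hx] using h6

/-! A weighted language that encodes a verifier -/

/-- The phases of reading a string of the form `1ᵏ 0 1ᵐ 0 0x₁ ⋯ 0xₙ 1` followed by `0` or by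
`1 w₁ ⋯ wₘ`. -/
inductive Phase
  | pad | len | sep | bit | flag | witness | fallback | dead
  deriving DecidableEq

instance : Fintype Phase :=
  ⟨{.pad, .len, .sep, .bit, .flag, .witness, .fallback, .dead}, fun k => by cases k <;> simp⟩

/-- The next phase, given a symbol, where `room` says whether more witness symbols are expected. -/
def Phase.next : Phase → Bool → Bool → Phase
  | .pad, true, _ => .pad
  | .pad, false, _ => .len
  | .len, true, _ => .len
  | .len, false, _ => .sep
  | .sep, false, _ => .bit
  | .sep, true, _ => .flag
  | .bit, _, _ => .sep
  | .flag, false, _ => .fallback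
  | .flag, true, _ => .witness
  | .witness, _, true => .witness
  | .witness, _, false => .dead
  | .fallback, _, _ => .dead
  | .dead, _, _ => .dead

/-- What has been read so far: the phase, the number of witness symbols that are still expected (in
unary), and the bits of the instance and of the witness, in reverse. -/
structure Parse where
  phase : Phase
  len : List Bool
  inst : List Bool
  wit : List Bool

namespace Parse

/-- The start. -/
def start : Parse := ⟨.pad, [], [], []⟩

/-- Reading a symbol. -/
def step (s : Parse) (b : Bool) : Parse where
  phase := s.phase.next b (!s.len.isEmpty)
  len := if s.phase = .len ∧ b = true then true :: s.len else
    if s.phase = .witness then s.len.tail else s.len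
  inst := if s.phase = .bit then b :: s.inst else s.inst
  wit := if s.phase = .witness then b :: s.wit else s.wit

/-- The kind of a string: `some true` for a fallback string, `some false` for a string with an
accepted witness, and `none` for all others. -/
def verdict (v : List Bool → List Bool → Bool) (s : Parse) : Option Bool :=
  if s.phase = .fallback then some true
  else if s.phase = .witness ∧ s.len = [] ∧ v s.inst.reverse s.wit.reverse = true then some false
  else none

theorem phase_foldl_dead (s : Parse) (h : s.phase = .dead) (y : List Bool) :
    (y.foldl step s).phase = .dead := by
  induction y generalizing s with
  | nil => exact h
  | cons b y ih => exact ih _ (by simp [step, h, Phase.next])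

theorem verdict_dead (v : List Bool → List Bool → Bool) (s : Parse) (h : s.phase = .dead) :
    s.verdict v = none := by
  simp [verdict, h]

theorem foldl_pad (k : ℕ) : (List.replicate k true).foldl step start = start := by
  induction k with
  | zero => rfl
  | succ k ih =>
    rw [List.replicate_succ, List.foldl_cons]
    exact ih

theorem foldl_len (m : ℕ) (l : List Bool) :
    (List.replicate m true).foldl step ⟨.len, l, [], []⟩ =
      ⟨.len, List.replicate m true ++ l, [], []⟩ := by
  induction m generalizing l with
  | zero => rfl
  | succ m ih =>
    rw [List.replicate_succ, List.foldl_cons, show step ⟨.len, l, [], []⟩ true =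
      ⟨.len, true :: l, [], []⟩ by simp [step, Phase.next], ih]
    simp [← List.replicate_append_replicate (n := m) (m := 1), ← List.replicate_succ,
      List.replicate_succ']

theorem foldl_inst (x l i : List Bool) :
    (x.flatMap (fun b => [false, b])).foldl step ⟨.sep, l, i, []⟩ =
      ⟨.sep, l, x.reverse ++ i, []⟩ := by
  induction x generalizing i with
  | nil => rfl
  | cons b x ih =>
    rw [List.flatMap_cons, List.foldl_append, show [false, b].foldl step ⟨.sep, l, i, []⟩ =
      ⟨.sep, l, b :: i, []⟩ by simp [step, Phase.next], ih]
    simp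

/-- Every witness symbol uses up one mark of `l`; a witness that is too long kills the parse for
good. -/
theorem foldl_wit (w l i z : List Bool) :
    (w.length ≤ l.length ∧ w.foldl step ⟨.witness, l, i, z⟩ =
      ⟨.witness, l.drop w.length, i, w.reverse ++ z⟩) ∨
    (l.length < w.length ∧ (w.foldl step ⟨.witness, l, i, z⟩).phase = .dead) := by
  induction w generalizing l z with
  | nil => left; simp
  | cons b w ih =>
    rw [List.foldl_cons]
    cases l with
    | nil => exact .inr ⟨by simp, phase_foldl_dead _ (by simp [step, Phase.next]) _⟩
    | cons a l =>
      rw [show step ⟨.witness, a :: l, i, z⟩ b = ⟨.witness, l, i, b :: z⟩ by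
        simp [step, Phase.next]]
      simpa using ih l (b :: z)

end Parse

/-- The beginning `1ᵏ 0 1ᵐ 0` of a string. -/
def header (k m : ℕ) : List Bool :=
  List.replicate k true ++ false :: (List.replicate m true ++ [false])

theorem foldl_query (k m : ℕ) (x : List Bool) :
    (query (header k m) x).foldl Parse.step .start =
      ⟨.flag, List.replicate m true, x.reverse, []⟩ := by
  rw [query, header]
  simp only [List.foldl_append, Parse.foldl_pad, List.foldl_cons, List.foldl_nil]
  rw [show Parse.step .start false = ⟨.len, [], [], []⟩ by
      simp [Parse.step, Parse.start, Phase.next], Parse.foldl_len,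
    show Parse.step ⟨.len, List.replicate m true ++ [], [], []⟩ false =
    ⟨.sep, List.replicate m true, [], []⟩ by simp [Parse.step, Phase.next], Parse.foldl_inst]
  simp [Parse.step, Phase.next]

/-- The weight of a string of length `l`, by kind. -/
noncomputable def kindWeight (l : ℕ) : Option Bool → ℝ≥0
  | none => 0
  | some false => (1 / 4) ^ l
  | some true => (1 / 16) ^ l

/-- The weighted language for a verifier. -/
noncomputable def verifierWeight (v : List Bool → List Bool → Bool) : WeightedLanguage := fun y =>
  kindWeight y.length ((y.foldl Parse.step .start).verdict v)

theorem kindWeight_le (l : ℕ) (o : Option Bool) : kindWeight l o ≤ (1 / 4) ^ l := by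
  rcases o with _ | _ | _
  · exact zero_le
  · exact le_rfl
  · refine pow_le_pow_left₀ (zero_le) ?_ l
    rw [← NNReal.coe_le_coe]
    norm_num

/-- The `2 ^ n` strings of length `n` contribute `(1 / 2) ^ n` together. -/
theorem summable_quarter_pow_length : Summable fun y : List Bool => ((1 / 4 : ℝ≥0)) ^ y.length := by
  rw [← NNReal.summable_coe, ← (Equiv.sigmaFiberEquiv (List.length (α := Bool))).summable_iff]
  have hfin : ∀ n, Fintype {l : List Bool // l.length = n} := fun n =>
    inferInstanceAs (Fintype (List.Vector Bool n))
  rw [summable_sigma_of_nonneg (fun _ => by exact NNReal.coe_nonneg _)]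
  refine ⟨fun n => (hasSum_fintype _).summable, ?_⟩
  have : ∀ n, ∑' y : {l : List Bool // l.length = n}, ((1 / 4 : ℝ)) ^ y.1.length =
      (1 / 2) ^ n := by
    intro n
    rw [tsum_fintype, Finset.sum_congr rfl (g := fun _ => ((1 / 4 : ℝ)) ^ n)
      (fun y _ => by rw [y.2]), Finset.sum_const, Finset.card_univ,
      show Fintype.card {l : List Bool // l.length = n} = 2 ^ n by
        rw [← Fintype.card_bool, ← card_vector (α := Bool) n]
        exact Fintype.card_congr (Equiv.refl _)]
    rw [nsmul_eq_mul]
    push_cast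
    rw [← mul_pow]
    norm_num
  refine (summable_geometric_two).congr fun n => ?_
  rw [← this]
  simp [Equiv.sigmaFiberEquiv]

/-! ### Weights of the continuations of a query -/

variable (v : List Bool → List Bool → Bool)

theorem summable_verifierWeight : Summable (verifierWeight v) :=
  NNReal.summable_of_le (fun _ => kindWeight_le _ _) summable_quarter_pow_length

theorem verifierWeight_fallback (k m : ℕ) (x : List Bool) :
    verifierWeight v (query (header k m) x ++ [false]) =
      (1 / 16) ^ ((query (header k m) x).length + 1) := by
  rw [verifierWeight, List.foldl_append, foldl_query]
  simp [Parse.step, Phase.next, Parse.verdict, kindWeight]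

theorem verifierWeight_fallback_append (k m : ℕ) (x z : List Bool) (hz : z ≠ []) :
    verifierWeight v (query (header k m) x ++ (false :: z)) = 0 := by
  obtain ⟨b, z, rfl⟩ := List.exists_cons_of_ne_nil hz
  rw [verifierWeight, List.foldl_append, foldl_query, List.foldl_cons, List.foldl_cons,
    Parse.verdict_dead]
  · rfl
  · exact Parse.phase_foldl_dead _ (by simp [Parse.step, Phase.next]) _

theorem verifierWeight_query (k m : ℕ) (x : List Bool) :
    verifierWeight v (query (header k m) x) = 0 := by
  rw [verifierWeight, foldl_query]
  simp [Parse.verdict, kindWeight]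

theorem verifierWeight_witness (k m : ℕ) (x w : List Bool) (hw : w.length = m)
    (hv : v x w = true) :
    verifierWeight v (query (header k m) x ++ (true :: w)) =
      (1 / 4) ^ ((query (header k m) x).length + 1 + m) := by
  rw [verifierWeight, List.foldl_append, foldl_query, List.foldl_cons,
    show Parse.step ⟨.flag, List.replicate m true, x.reverse, []⟩ true =
      ⟨.witness, List.replicate m true, x.reverse, []⟩ by simp [Parse.step, Phase.next]]
  rcases Parse.foldl_wit w (List.replicate m true) x.reverse [] with ⟨-, h⟩ | ⟨h, -⟩
  · rw [h]
    simp [Parse.verdict, hw, hv, kindWeight, ← add_assoc, add_right_comm]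
  · simp [hw] at h

theorem verifierWeight_no_witness (k m : ℕ) (x z : List Bool)
    (hv : ∀ w, w.length = m → v x w = false) :
    verifierWeight v (query (header k m) x ++ (true :: z)) = 0 := by
  rw [verifierWeight, List.foldl_append, foldl_query, List.foldl_cons,
    show Parse.step ⟨.flag, List.replicate m true, x.reverse, []⟩ true =
      ⟨.witness, List.replicate m true, x.reverse, []⟩ by simp [Parse.step, Phase.next]]
  rcases Parse.foldl_wit z (List.replicate m true) x.reverse [] with ⟨h1, h⟩ | ⟨-, h⟩
  · rw [h]
    suffices h2 : ¬ (m ≤ z.length ∧ v x z = true) by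
      simp [Parse.verdict, kindWeight, Nat.sub_eq_zero_iff_le, h2]
    rintro ⟨h3, h4⟩
    simp at h1
    rw [hv z (by omega)] at h4
    simp at h4
  · rw [Parse.verdict_dead v _ h]
    rfl

theorem normalizable_verifierWeight : Normalizable (verifierWeight v) := by
  refine ⟨summable_verifierWeight v, ?_⟩
  have h : 0 < verifierWeight v (query (header 0 0) [] ++ [false]) := by
    rw [verifierWeight_fallback]
    exact pow_pos (by norm_num) _
  exact NNReal.tsum_pos (summable_verifierWeight v) _ h

/-! ### Prefix weights and local probabilities at a query -/

theorem prefixWeight_eq_single (p : WeightedLanguage) (y z : List Bool) (hz : y <+: z)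
    (h : ∀ z', y <+: z' → z' ≠ z → p z' = 0) : prefixWeight p y = p z := by
  rw [prefixWeight, tsum_eq_single ⟨z, hz⟩]
  rintro ⟨z', hz'⟩ hne
  exact h z' hz' fun he => hne (Subtype.ext he)

theorem prefixWeight_fallback (k m : ℕ) (x : List Bool) :
    prefixWeight (verifierWeight v) (query (header k m) x ++ [false]) =
      (1 / 16) ^ ((query (header k m) x).length + 1) := by
  rw [← verifierWeight_fallback v]
  refine prefixWeight_eq_single _ _ _ (List.prefix_refl _) ?_
  rintro z' ⟨z, rfl⟩ hne
  rw [List.append_assoc]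
  exact verifierWeight_fallback_append v k m x z fun h => hne (by simp [h])

theorem le_prefixWeight {p : WeightedLanguage} (hp : Summable p) (y z : List Bool)
    (hz : y <+: z) : p z ≤ prefixWeight p y := by
  have h : Summable (p ∘ (Subtype.val : {z : List Bool // y <+: z} → List Bool)) :=
    NNReal.summable_comp_injective hp Subtype.val_injective
  exact h.le_tsum ⟨z, hz⟩ fun _ _ => zero_le

theorem prefixWeight_query_pos (k m : ℕ) (x : List Bool) :
    0 < prefixWeight (verifierWeight v) (query (header k m) x) := by
  refine lt_of_lt_of_le ?_ (le_prefixWeight (summable_verifierWeight v) _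
    (query (header k m) x ++ [false]) ⟨_, rfl⟩)
  rw [verifierWeight_fallback]
  exact pow_pos (by norm_num) _

theorem localProb_pos (k m : ℕ) (x : List Bool) :
    0 < localProb (verifierWeight v) (query (header k m) x) (some false) := by
  rw [localProb, prefixWeight_fallback]
  exact div_pos (pow_pos (by norm_num) _) (prefixWeight_query_pos v k m x)

/-- Without a witness the fallback string carries the entire weight below the query. -/
theorem localProb_eq_one (k m : ℕ) (x : List Bool) (hv : ∀ w, w.length = m → v x w = false) :
    localProb (verifierWeight v) (query (header k m) x) (some false) = 1 := by
  rw [localProb, prefixWeight_fallback, prefixWeight_eq_single _ _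
    (query (header k m) x ++ [false]) ⟨_, rfl⟩, verifierWeight_fallback]
  · exact div_self (pow_pos (by norm_num) _).ne'
  · rintro z' ⟨z, rfl⟩ hne
    rcases z with _ | ⟨_ | _, z⟩
    · rw [List.append_nil]
      exact verifierWeight_query v k m x
    · exact verifierWeight_fallback_append v k m x z fun h => hne (by simp [h])
    · exact verifierWeight_no_witness v k m x z hv

theorem length_header (k m : ℕ) : (header k m).length = k + m + 2 := by
  simp [header]
  omega

/-- One witness string bounds `Z` of the query from below. It is longer than the fallback by `m`,
but the query contains `m` in unary, so the smaller base of the fallback more than makes up for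
this. -/
theorem localProb_le (k m : ℕ) (x w : List Bool) (hw : w.length = m) (hv : v x w = true) :
    localProb (verifierWeight v) (query (header k m) x) (some false) * 2 ^ k ≤ 1 := by
  have h1 := le_prefixWeight (summable_verifierWeight v) (query (header k m) x)
    (query (header k m) x ++ (true :: w)) ⟨_, rfl⟩
  rw [verifierWeight_witness v k m x w hw hv] at h1
  rw [localProb, prefixWeight_fallback, div_mul_eq_mul_div,
    div_le_one (prefixWeight_query_pos v k m x)]
  refine le_trans ?_ h1
  have hl : (query (header k m) x).length = k + m + 2 + 2 * x.length + 1 := by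
    rw [length_query, length_header]
  generalize (query (header k m) x).length = l at *
  -- In powers of 2 the claim is `k + 2 * (l + 1 + m) ≤ 4 * (l + 1)`, which holds because `l ≥ k +
  -- m`.
  rw [one_div, one_div, inv_pow, inv_pow, inv_mul_le_iff₀ (by positivity), ← div_eq_mul_inv,
    le_div_iff₀ (by positivity), show (16 : ℝ≥0) = 2 ^ 4 by norm_num,
    show (4 : ℝ≥0) = 2 ^ 2 by norm_num, ← pow_mul, ← pow_mul, ← pow_add]
  exact pow_le_pow_right₀ (by norm_num) (by omega)

/-! A machine that computes the weights -/

namespace WeightMachine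

/-- The stacks in addition to those of the verifier: the input, a counter for its length, the three
components of a `Parse`, and the output. -/
inductive Aux
  | inp | cnt | len | inst | wit | out
  deriving DecidableEq

instance : Fintype Aux :=
  ⟨{.inp, .cnt, .len, .inst, .wit, .out}, fun k => by cases k <;> simp⟩

/-- The alphabets of the additional stacks. -/
@[reducible] def AuxAlphabet : Aux → Type
  | .out => Option Bool
  | _ => Bool

/-- The labels in addition to those of the verifier. -/
inductive Label
  | read | loadWit | loadInst | verdict | clear | emit
  deriving DecidableEq

instance : Fintype Label :=
  ⟨{.read, .loadWit, .loadInst, .verdict, .clear, .emit}, fun k => by cases k <;> simp⟩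

/-- The registers in addition to the state of the verifier. -/
structure Reg where
  phase : Phase
  a : Option Bool
  b : Option Bool
  c : Option Bool
  kind : Option Bool
  deriving Fintype

/-- The registers between two steps. -/
def reg (ph : Phase) (kind : Option Bool) : Reg := ⟨ph, none, none, none, kind⟩

variable (V : Turing.TM2ComputableAux (Option Bool) Bool)

/-- The stack alphabets. -/
@[reducible] def Alphabet : V.tm.K ⊕ Aux → Type
  | .inl k => V.tm.Γ k
  | .inr k => AuxAlphabet k

/-- The statements of the machine. -/
abbrev Stmt : Type := Turing.TM2.Stmt (Alphabet V) (V.tm.Λ ⊕ Label) (V.tm.σ × Reg)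

open Turing.TM2.Stmt

/-- A statement of the verifier, as a statement of the machine. -/
def lift : Turing.TM2.Stmt V.tm.Γ V.tm.Λ V.tm.σ → Stmt V
  | push k f q => push (.inl k) (fun s => f s.1) (lift q)
  | peek k f q => peek (.inl k) (fun s a => (f s.1 a, s.2)) (lift q)
  | pop k f q => pop (.inl k) (fun s a => (f s.1 a, s.2)) (lift q)
  | load f q => load (fun s => (f s.1, s.2)) (lift q)
  | branch f q₁ q₂ => branch (fun s => f s.1) (lift q₁) (lift q₂)
  | goto f => goto fun s => .inl (f s.1)
  | halt => goto fun _ => .inr .verdict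

/-- The end of every step: empty the scratch registers and go to `l`. -/
def jump (l : V.tm.Λ ⊕ Label) : Stmt V :=
  load (fun s => (s.1, reg s.2.phase s.2.kind)) <| goto fun _ => l

/-- Go on with a given kind. -/
def finish (f : Reg → Option Bool) : Stmt V :=
  load (fun s => (s.1, { s.2 with kind := f s.2 })) <| jump V (.inr .clear)

/-- Go on with the next symbol. -/
def continue_ : Stmt V :=
  load (fun s => (s.1, { s.2 with phase := s.2.phase.next (s.2.a.getD false) s.2.b.isSome })) <|
    jump V (.inr .read)

/-- The program. -/
def program : V.tm.Λ ⊕ Label → Stmt V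
  | .inl l => lift V (V.tm.m l)
  | .inr .read =>
    pop (.inr .inp) (fun s a => (s.1, { s.2 with a := a })) <|
    branch (fun s => s.2.a.isSome)
      (push (.inr .cnt) (fun _ => true) <|
       branch (fun s => decide (s.2.phase = .witness))
        (push (.inr .wit) (fun s => s.2.a.getD false) <|
         pop (.inr .len) (fun s b => (s.1, { s.2 with b := b })) <| continue_ V) <|
       branch (fun s => decide (s.2.phase = .len) && s.2.a == some true)
        (push (.inr .len) (fun _ => true) <| continue_ V) <|
       branch (fun s => decide (s.2.phase = .bit))
        (push (.inr .inst) (fun s => s.2.a.getD false) <| continue_ V) <|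
       continue_ V) <|
    branch (fun s => decide (s.2.phase = .fallback)) (finish V fun _ => some true) <|
    branch (fun s => decide (s.2.phase = .witness))
      (pop (.inr .len) (fun s b => (s.1, { s.2 with b := b })) <|
       branch (fun s => s.2.b.isSome) (finish V fun _ => none) <| jump V (.inr .loadWit)) <|
    finish V fun _ => none
  | .inr .loadWit =>
    pop (.inr .wit) (fun s a => (s.1, { s.2 with a := a })) <|
    -- When the witness stack is exhausted, the popped `none` is itself the separator that has to be
    -- pushed next.
    push (.inl V.tm.k₀) (fun s => V.inputAlphabet.symm s.2.a) <|
    branch (fun s => s.2.a.isSome) (jump V (.inr .loadWit)) (jump V (.inr .loadInst))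
  | .inr .loadInst =>
    pop (.inr .inst) (fun s a => (s.1, { s.2 with a := a })) <|
    branch (fun s => s.2.a.isSome)
      (push (.inl V.tm.k₀) (fun s => V.inputAlphabet.symm s.2.a) <| jump V (.inr .loadInst))
      (jump V (.inl V.tm.main))
  | .inr .verdict =>
    pop (.inl V.tm.k₁) (fun s a => (s.1, { s.2 with a := a.map V.outputAlphabet })) <|
    finish V fun r => if r.a = some true then some false else none
  | .inr .clear =>
    pop (.inr .len) (fun s a => (s.1, { s.2 with a := a })) <|
    pop (.inr .inst) (fun s a => (s.1, { s.2 with b := a })) <|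
    pop (.inr .wit) (fun s a => (s.1, { s.2 with c := a })) <|
    branch (fun s => s.2.a.isSome || s.2.b.isSome || s.2.c.isSome)
      (jump V (.inr .clear))
      -- The fraction is pushed back to front: the leading 1 of the denominator, its zeros, the
      -- separator, the one-digit numerator.
      (push (.inr .out) (fun _ => some true) <| jump V (.inr .emit))
  | .inr .emit =>
    pop (.inr .cnt) (fun s a => (s.1, { s.2 with a := a })) <|
    branch (fun s => s.2.a.isSome)
      (push (.inr .out) (fun _ => some false) <|
       push (.inr .out) (fun _ => some false) <|
       branch (fun s => decide (s.2.kind = some true))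
        (push (.inr .out) (fun _ => some false) <|
         push (.inr .out) (fun _ => some false) <| jump V (.inr .emit)) <|
       jump V (.inr .emit)) <|
    push (.inr .out) (fun _ => none) <|
    push (.inr .out) (fun s => some s.2.kind.isSome) <|
    load (fun _ => (V.tm.initialState, reg .pad none)) halt

/-- The machine. -/
def machine : Turing.TM2ComputableAux Bool (Option Bool) where
  tm :=
    { K := V.tm.K ⊕ Aux
      kFin := @instFintypeSum _ _ V.tm.kFin _
      k₀ := .inr .inp
      k₁ := .inr .out
      Γ := Alphabet V
      Λ := V.tm.Λ ⊕ Label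
      ΛFin := @instFintypeSum _ _ V.tm.ΛFin _
      main := .inr .read
      σ := V.tm.σ × Reg
      σFin := @instFintypeProd _ _ V.tm.σFin _
      initialState := (V.tm.initialState, reg .pad none)
      Γk₀Fin := inferInstanceAs (Fintype Bool)
      m := program V }
  inputAlphabet := Equiv.refl _
  outputAlphabet := Equiv.refl _

variable {V}

/-- The contents of the stacks. -/
def store (S : ∀ k, List (V.tm.Γ k)) (i c l x w : List Bool) (o : List (Option Bool)) :
    ∀ k, List (Alphabet V k)
  | .inl k => S k
  | .inr .inp => i
  | .inr .cnt => c
  | .inr .len => l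
  | .inr .inst => x
  | .inr .wit => w
  | .inr .out => o

section
variable (S : ∀ k, List (V.tm.Γ k)) (i c l x w z : List Bool) (o o' : List (Option Bool))

@[simp] theorem store_inl (k : V.tm.K) : store S i c l x w o (.inl k) = S k := rfl
@[simp] theorem store_inp : store S i c l x w o (.inr .inp) = i := rfl
@[simp] theorem store_cnt : store S i c l x w o (.inr .cnt) = c := rfl
@[simp] theorem store_len : store S i c l x w o (.inr .len) = l := rfl
@[simp] theorem store_inst : store S i c l x w o (.inr .inst) = x := rfl
@[simp] theorem store_wit : store S i c l x w o (.inr .wit) = w := rfl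
@[simp] theorem store_out : store S i c l x w o (.inr .out) = o := rfl

@[simp] theorem update_inl (k : V.tm.K) (s : List (V.tm.Γ k)) :
    Function.update (store S i c l x w o) (.inl k) s =
      store (Function.update S k s) i c l x w o := by
  funext k'
  rcases k' with k' | _ | _ | _ | _ | _ | _
  · by_cases h : k' = k
    · subst h; simp
    · rw [Function.update_of_ne (by simpa using h)]
      simp [h]
  all_goals rfl
@[simp] theorem update_inp :
    Function.update (store S i c l x w o) (.inr .inp) z = store S z c l x w o := by
  funext k; rcases k with _ | _ | _ | _ | _ | _ | _ <;> rfl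
@[simp] theorem update_cnt :
    Function.update (store S i c l x w o) (.inr .cnt) z = store S i z l x w o := by
  funext k; rcases k with _ | _ | _ | _ | _ | _ | _ <;> rfl
@[simp] theorem update_len :
    Function.update (store S i c l x w o) (.inr .len) z = store S i c z x w o := by
  funext k; rcases k with _ | _ | _ | _ | _ | _ | _ <;> rfl
@[simp] theorem update_inst :
    Function.update (store S i c l x w o) (.inr .inst) z = store S i c l z w o := by
  funext k; rcases k with _ | _ | _ | _ | _ | _ | _ <;> rfl
@[simp] theorem update_wit :
    Function.update (store S i c l x w o) (.inr .wit) z = store S i c l x z o := by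
  funext k; rcases k with _ | _ | _ | _ | _ | _ | _ <;> rfl
@[simp] theorem update_out :
    Function.update (store S i c l x w o) (.inr .out) o' = store S i c l x w o' := by
  funext k; rcases k with _ | _ | _ | _ | _ | _ | _ <;> rfl

end

/-- The stacks of the verifier, all empty but one. -/
def single (k : V.tm.K) (s : List (V.tm.Γ k)) : ∀ k, List (V.tm.Γ k) :=
  Function.update (fun _ => []) k s

@[simp] theorem single_self (k : V.tm.K) (s : List (V.tm.Γ k)) : single k s k = s := by
  simp [single]

@[simp] theorem update_single (k : V.tm.K) (s s' : List (V.tm.Γ k)) :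
    Function.update (single k s) k s' = single k s' := by
  simp [single]

@[simp] theorem single_nil (k : V.tm.K) : single k [] = fun _ => ([] : List (V.tm.Γ _)) := by
  simp [single]

/-- A configuration between two steps. -/
def cfg (lab : Label) (ph : Phase) (kind : Option Bool) (S : ∀ k, List (V.tm.Γ k))
    (i c l x w : List Bool) (o : List (Option Bool)) :
    Turing.TM2.Cfg (Alphabet V) (V.tm.Λ ⊕ Label) (V.tm.σ × Reg) :=
  ⟨some (.inr lab), (V.tm.initialState, reg ph kind), store S i c l x w o⟩

/-- A configuration of the verifier, as a configuration of the machine. -/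
def liftCfg (r : Reg) (c : List Bool) (a : Turing.TM2.Cfg V.tm.Γ V.tm.Λ V.tm.σ) :
    Turing.TM2.Cfg (Alphabet V) (V.tm.Λ ⊕ Label) (V.tm.σ × Reg) :=
  ⟨some (a.l.elim (.inr .verdict) .inl), (a.var, r), store a.stk [] c [] [] [] []⟩

/-- Lifted statements touch only the verifier's own stacks and state, and halting becomes the jump
to `verdict`. Of the additional stacks only the counter is in use meanwhile. -/
theorem stepAux_lift (r : Reg) (c : List Bool) (q : Turing.TM2.Stmt V.tm.Γ V.tm.Λ V.tm.σ)
    (s : V.tm.σ) (S : ∀ k, List (V.tm.Γ k)) :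
    Turing.TM2.stepAux (lift V q) (s, r) (store S [] c [] [] [] []) =
      liftCfg r c (Turing.TM2.stepAux q s S) := by
  induction q generalizing s S with
  | push k f q ih => simp [lift, ih]
  | peek k f q ih => simp [lift, ih]
  | pop k f q ih => simp [lift, ih]
  | load f q ih => simp [lift, ih]
  | branch f q₁ q₂ ih₁ ih₂ =>
    simp only [lift, Turing.TM2.stepAux]
    cases f s
    · exact ih₂ s S
    · exact ih₁ s S
  | goto f => rfl
  | halt => rfl

theorem reach_lift (r : Reg) (c : List Bool) {a b : Turing.TM2.Cfg V.tm.Γ V.tm.Λ V.tm.σ} {t : ℕ}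
    (h : Reach V.tm.m a t b) : Reach (program V) (liftCfg r c a) t (liftCfg r c b) := by
  refine h.map (liftCfg r c) ?_
  rintro ⟨l, s, S⟩ b h
  cases l with
  | none => simp at h
  | some l =>
    simp at h
    subst h
    simp [liftCfg, program, stepAux_lift]

/-- The machine inspects the stack `len` only in the witness phase, so elsewhere it does not know
whether there is room. -/
theorem next_of_ne_witness {ph : Phase} (h : ph ≠ .witness) (b r r' : Bool) :
    ph.next b r = ph.next b r' := by
  cases ph <;> cases b <;> first | rfl | exact absurd rfl h

theorem reach_read (y c : List Bool) (s : Parse) (S : ∀ k, List (V.tm.Γ k)) :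
    Reach (program V) (cfg .read s.phase none S y c s.len s.inst s.wit []) y.length
      (cfg .read (y.foldl Parse.step s).phase none S [] (List.replicate y.length true ++ c)
        (y.foldl Parse.step s).len (y.foldl Parse.step s).inst (y.foldl Parse.step s).wit []) := by
  induction y generalizing c s with
  | nil => exact Reach.refl _ _
  | cons b y ih =>
    have h := ih (true :: c) (s.step b)
    have h' : List.replicate (b :: y).length true ++ c =
        List.replicate y.length true ++ true :: c := by
      simp [List.replicate_succ']
    rw [h', List.foldl_cons]
    refine Reach.head ?_ h
    obtain ⟨ph, l, x, w⟩ := s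
    by_cases hw : ph = .witness
    · subst hw
      cases l <;> simp [cfg, program, reg, continue_, jump, Parse.step]
    · have hn := fun b r => next_of_ne_witness hw b r false
      by_cases hl : ph = .len
      · subst hl
        cases b <;> simp [cfg, program, reg, continue_, jump, Parse.step, Phase.next]
      · by_cases hb : ph = .bit
        · subst hb
          simp [cfg, program, reg, continue_, jump, Parse.step, Phase.next]
        · simp [cfg, program, reg, continue_, jump, Parse.step, hw, hl, hb, hn]

theorem reach_loadWit (w x c : List Bool) (ph : Phase) (s : List (Option Bool)) :
    Reach (program V)
      (cfg .loadWit ph none (single V.tm.k₀ (s.map V.inputAlphabet.symm)) [] c [] x w [])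
      (w.length + 1)
      (cfg .loadInst ph none
        (single V.tm.k₀ ((none :: (w.reverse.map some ++ s)).map V.inputAlphabet.symm))
        [] c [] x [] []) := by
  induction w generalizing s with
  | nil => exact Reach.single (by simp [cfg, program, reg, jump])
  | cons b w ih =>
    refine Reach.head ?_ (by simpa using ih (some b :: s))
    simp [cfg, program, reg, jump]

theorem reach_loadInst (x c : List Bool) (ph : Phase) (s : List (Option Bool)) :
    Reach (program V)
      (cfg .loadInst ph none (single V.tm.k₀ (s.map V.inputAlphabet.symm)) [] c [] x [] [])
      (x.length + 1)
      (liftCfg (reg ph none) c ⟨some V.tm.main, V.tm.initialState,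
        single V.tm.k₀ ((x.reverse.map some ++ s).map V.inputAlphabet.symm)⟩) := by
  induction x generalizing s with
  | nil => exact Reach.single (by simp [cfg, liftCfg, program, reg, jump])
  | cons b x ih =>
    refine Reach.head ?_ (by simpa using ih (some b :: s))
    simp [cfg, program, reg, jump]

theorem reach_verdict (c : List Bool) (ph : Phase) (b : Bool) :
    Reach (program V)
      (liftCfg (reg ph none) c ⟨none, V.tm.initialState,
        single V.tm.k₁ ([b].map V.outputAlphabet.symm)⟩) 1
      (cfg .clear ph (if b = true then some false else none) (fun _ => []) [] c [] [] [] []) := by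
  refine Reach.single ?_
  cases b <;> simp [cfg, liftCfg, program, reg, jump, finish]

/-- The three stacks shrink simultaneously, so the longest one determines the time. -/
theorem reach_clear (n : ℕ) (l x w c : List Bool) (ph : Phase) (kind : Option Bool)
    (S : ∀ k, List (V.tm.Γ k)) (hl : l.length ≤ n) (hx : x.length ≤ n) (hw : w.length ≤ n) :
    Reach (program V) (cfg .clear ph kind S [] c l x w []) (n + 1)
      (cfg .emit ph kind S [] c [] [] [] [some true]) := by
  induction n generalizing l x w with
  | zero =>
    simp at hl hx hw
    subst hl hx hw
    exact Reach.single (by simp [cfg, program, reg, jump])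
  | succ n ih =>
    by_cases h : l = [] ∧ x = [] ∧ w = []
    · obtain ⟨rfl, rfl, rfl⟩ := h
      exact (Reach.single (by simp [cfg, program, reg, jump])).mono (by omega)
    · refine Reach.head ?_ (ih l.tail x.tail w.tail (by simp; omega) (by simp; omega)
        (by simp; omega))
      rcases l with _ | ⟨a, l⟩ <;> rcases x with _ | ⟨b, x⟩ <;> rcases w with _ | ⟨d, w⟩ <;>
        first | exact absurd ⟨rfl, rfl, rfl⟩ h | simp [cfg, program, reg, jump]

/-- The number of digits of the denominator for every symbol of the input. -/
def rate (kind : Option Bool) : ℕ := if kind = some true then 4 else 2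

theorem reach_emit (c : List Bool) (ph : Phase) (kind : Option Bool)
    (S : ∀ k, List (V.tm.Γ k)) (o : List (Option Bool)) :
    Reach (program V) (cfg .emit ph kind S [] c [] [] [] o) (c.length + 1)
      ⟨none, (V.tm.initialState, reg .pad none), store S [] [] [] [] []
        (some kind.isSome :: none :: (List.replicate (rate kind * c.length) (some false) ++ o))⟩ := by
  induction c generalizing o with
  | nil => exact Reach.single (by simp [cfg, program, reg, jump])
  | cons a c ih =>
    have h := ih (List.replicate (rate kind) (some false) ++ o)
    rw [← List.append_assoc, List.replicate_append_replicate, ← Nat.mul_succ] at h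
    refine Reach.head ?_ h
    by_cases hk : kind = some true
    · subst hk
      simp [cfg, program, reg, jump, rate]
    · simp [cfg, program, reg, jump, rate, hk]

theorem length_foldl_step (y : List Bool) (s : Parse) :
    (y.foldl Parse.step s).len.length ≤ s.len.length + y.length ∧
    (y.foldl Parse.step s).inst.length ≤ s.inst.length + y.length ∧
    (y.foldl Parse.step s).wit.length ≤ s.wit.length + y.length := by
  induction y generalizing s with
  | nil => simp
  | cons b y ih =>
    rw [List.foldl_cons]
    have h := ih (s.step b)
    have h1 : (s.step b).len.length ≤ s.len.length + 1 := by
      simp only [Parse.step]; split_ifs <;> simp; omega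
    have h2 : (s.step b).inst.length ≤ s.inst.length + 1 := by
      simp only [Parse.step]; split_ifs <;> simp
    have h3 : (s.step b).wit.length ≤ s.wit.length + 1 := by
      simp only [Parse.step]; split_ifs <;> simp
    simp only [List.length_cons]
    omega

theorem reach_kind (v : List Bool → List Bool → Bool) (t : Polynomial ℕ)
    (hV : ∀ x w, Computes V (pairEnc x w) [v x w] (t.eval (x.length + w.length)))
    (s : Parse) (c : List Bool) (n : ℕ) (hl : s.len.length ≤ n) (hi : s.inst.length ≤ n)
    (hw : s.wit.length ≤ n) :
    Reach (program V) (cfg .read s.phase none (fun _ => []) [] c s.len s.inst s.wit [])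
      (t.eval (2 * n) + 3 * n + 5)
      (cfg .emit s.phase (s.verdict v) (fun _ => []) [] c [] [] [] [some true]) := by
  obtain ⟨ph, l, x, w⟩ := s
  simp only at hl hi hw
  by_cases hf : ph = .fallback
  · subst hf
    refine ((Reach.single
      (b := cfg .clear .fallback (some true) (fun _ => []) [] c l x w []) ?_).trans
      (reach_clear n l x w c _ _ _ hl hi hw)).mono (by omega)
    simp [cfg, program, reg, jump, finish]
  · by_cases hph : ph = .witness
    · subst hph
      cases l with
      | cons a l =>
        have h1 : Parse.verdict v ⟨.witness, a :: l, x, w⟩ = none := by simp [Parse.verdict]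
        rw [h1]
        refine ((Reach.single (b := cfg .clear .witness none (fun _ => []) [] c l x w []) ?_).trans
          (reach_clear n l x w c _ _ _ (by simp at hl; omega) hi hw)).mono (by omega)
        simp [cfg, program, reg, jump, finish]
      | nil =>
        have h1 : Parse.verdict v ⟨.witness, [], x, w⟩ =
            if v x.reverse w.reverse = true then some false else none := by
          simp [Parse.verdict]
        have h2 : Reach (program V) (cfg .read .witness none (fun _ => []) [] c [] x w []) 1
            (cfg .loadWit .witness none (single V.tm.k₀ (([] : List (Option Bool)).map
              V.inputAlphabet.symm)) [] c [] x w []) :=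
          Reach.single (by simp [cfg, program, reg, jump])
        have h3 := hV x.reverse w.reverse
        rw [computes_iff, initList_eq V.tm _ (single V.tm.k₀ ((pairEnc x.reverse w.reverse).map
            V.inputAlphabet.symm)) (by simp) (fun k hk => by simp [single, hk]),
          haltList_eq V.tm _ (single V.tm.k₁ ([v x.reverse w.reverse].map V.outputAlphabet.symm))
            (by simp) (fun k hk => by simp [single, hk])] at h3
        have h4 := reach_lift (reg .witness none) c h3
        have h5 := reach_loadInst (V := V) x c .witness (none :: (w.reverse.map some ++ []))
        rw [List.append_nil] at h5
        have h6 := reach_loadWit (V := V) w x c .witness []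
        rw [List.append_nil] at h6
        rw [h1]
        refine (((((h2.trans h6).trans h5).trans h4).trans (reach_verdict c _ _)).trans
          (reach_clear 0 [] [] [] c _ _ _ le_rfl le_rfl le_rfl)).mono ?_
        have h7 := eval_mono_nat t (show x.reverse.length + w.reverse.length ≤ 2 * n by
          simp; omega)
        simp only at h7
        omega
    · have h1 : Parse.verdict v ⟨ph, l, x, w⟩ = none := by simp [Parse.verdict, hf, hph]
      rw [h1]
      refine ((Reach.single (b := cfg .clear ph none (fun _ => []) [] c l x w []) ?_).trans
        (reach_clear n l x w c _ _ _ hl hi hw)).mono (by omega)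
      simp [cfg, program, reg, jump, finish, hf, hph]

theorem computes (v : List Bool → List Bool → Bool) (t : Polynomial ℕ)
    (hV : ∀ x w, Computes V (pairEnc x w) [v x w] (t.eval (x.length + w.length)))
    (y : List Bool) :
    Computes (machine V) y
      (pairEnc [((y.foldl Parse.step .start).verdict v).isSome]
        (List.replicate (rate ((y.foldl Parse.step .start).verdict v) * y.length) false ++ [true]))
      (t.eval (2 * y.length) + 5 * y.length + 6) := by
  have ho : pairEnc [((y.foldl Parse.step .start).verdict v).isSome]
      (List.replicate (rate ((y.foldl Parse.step .start).verdict v) * y.length) false ++ [true]) =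
      some ((y.foldl Parse.step .start).verdict v).isSome :: none ::
        (List.replicate (rate ((y.foldl Parse.step .start).verdict v) * y.length) (some false) ++
          [some true]) := by
    simp [pairEnc]
  rw [ho, computes_iff, initList_eq (machine V).tm _ (store (fun _ => []) y [] [] [] [] [])
      (by simp [machine]) (by
        rintro (k | _ | _ | _ | _ | _ | _) hk <;> first | rfl | exact absurd rfl hk),
    haltList_eq (machine V).tm _ (store (fun _ => []) [] [] [] [] []
      (some ((y.foldl Parse.step .start).verdict v).isSome :: none ::
        (List.replicate (rate ((y.foldl Parse.step .start).verdict v) * y.length) (some false) ++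
          [some true])))
      (by simp [machine]) (by
        rintro (k | _ | _ | _ | _ | _ | _) hk <;> first | rfl | exact absurd rfl hk)]
  have h1 := reach_read (V := V) y [] .start (fun _ => [])
  have h2 := length_foldl_step y .start
  simp only [Parse.start, List.length_nil, zero_add] at h2
  have h3 := reach_kind v t hV (y.foldl Parse.step .start)
    (List.replicate y.length true ++ []) y.length h2.1 h2.2.1 h2.2.2
  have h4 := reach_emit (V := V) (List.replicate y.length true ++ [])
    (y.foldl Parse.step .start).phase ((y.foldl Parse.step .start).verdict v) (fun _ => [])
    [some true]
  have h5 := ((h1.trans h3).trans h4).mono (t := t.eval (2 * y.length) + 5 * y.length + 6)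
    (by simp; omega)
  simp only [List.append_nil, List.length_replicate] at h5
  exact h5

end WeightMachine

theorem binValue_replicate_false (n : ℕ) : binValue (List.replicate n false ++ [true]) = 2 ^ n := by
  induction n with
  | zero => rfl
  | succ n ih =>
    rw [List.replicate_succ, List.cons_append, binValue_cons, ih, pow_succ]
    simp [mul_comm]

theorem efficientlyComputable_verifierWeight {V : Turing.TM2ComputableAux (Option Bool) Bool}
    {v : List Bool → List Bool → Bool} {t : Polynomial ℕ}
    (hV : ∀ x w, Computes V (pairEnc x w) [v x w] (t.eval (x.length + w.length))) :
    EfficientlyComputable (verifierWeight v) := by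
  refine ⟨WeightMachine.machine V, t.comp (2 * Polynomial.X) + 5 * Polynomial.X + 6, fun y => ?_⟩
  -- The output is `0` or `1` over `2 ^ (rate * length)`, where the rates 2 and 4 give the bases 4
  -- and 16.
  refine ⟨_, _, by simpa using WeightMachine.computes v t hV y, ⟨_, _, rfl, ?_, rfl⟩, ?_⟩
  · rw [binValue_replicate_false]
    positivity
  · rw [binValue_replicate_false, verifierWeight]
    rcases (y.foldl Parse.step .start).verdict v with _ | _ | _
    · simp [kindWeight, binValue]
    · simp [kindWeight, binValue, WeightMachine.rate, pow_mul]
    · simp [kindWeight, binValue, WeightMachine.rate, pow_mul]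

end LocalNorm

theorem theorem2 (hNP : ¬ LocalNorm.NP ⊆ LocalNorm.PPoly) :
    ∃ p : LocalNorm.WeightedLanguage,
      LocalNorm.Normalizable p ∧ LocalNorm.EfficientlyComputable p ∧
      ∀ lam : ℝ, 1 ≤ lam →
        ¬ ∃ (M : Turing.TM2ComputableAux Bool Bool) (θ : ℕ → List Bool),
          LocalNorm.ApproximatelyLocallyNormalizes lam p M θ := by
  obtain ⟨L, ⟨V, v, w, t, hV, hL⟩, hL'⟩ := Set.not_subset.1 hNP
  refine ⟨LocalNorm.verifierWeight v, LocalNorm.normalizable_verifierWeight v,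
    LocalNorm.efficientlyComputable_verifierWeight hV, ?_⟩
  rintro lam hlam ⟨M, θ, h⟩
  obtain ⟨j, hj⟩ := pow_unbounded_of_one_lt lam one_lt_two
  refine hL' (LocalNorm.mem_PPoly_of_approximatelyLocallyNormalizes L hlam h j hj.le
    -- Of the padding, `j` covers the factor `lam`, another `j` the threshold `2⁻ʲ`, and 1 the
    -- factor 2 lost in decoding.
    (fun n => LocalNorm.header (2 * j + 1) (w.eval n))
    (Polynomial.C (2 * j + 4) + w + 2 * Polynomial.X) (fun x => ?_)
    (fun x => LocalNorm.localProb_pos v _ _ x) (fun x hx => ?_) fun x hx => ?_)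
  · rw [LocalNorm.length_query, LocalNorm.length_header]
    simp only [Polynomial.eval_add, Polynomial.eval_C, Polynomial.eval_mul, Polynomial.eval_X,
      Polynomial.eval_ofNat]
    omega
  · refine LocalNorm.localProb_eq_one v _ _ x fun z hz => ?_
    rw [hL] at hx
    by_contra hvz
    exact hx ⟨z, hz, by simpa using hvz⟩
  · obtain ⟨z, hz, hvz⟩ := (hL x).1 hx
    exact LocalNorm.localProb_le v _ _ x z hz hvz
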